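/- Let $V(z,\omega)$, $z\in\mathbb Z$, be i.i.d. random variables with values in $[0,\infty]$ on a probability space $(\Omega,\mathcal F,\mathbb P)$, and let $\kappa,K\in(0,\infty)$ be such that $\mathbb P(V(0,\cdot)\in[\kappa,K])>0$. Call a site $z\in\mathbb Z$ reasonable in the environment $\omega$ if $V(z,\omega)\in[\kappa,K]$. For integers $a=x_0<x_1<\dots<x_m<x_{m+1}=b$, $m\ge 0$, let $\Omega_{(a,b)}(x_1,\dots,x_m)$ be the event that the reasonable sites in $(a,b)$ are exactly $x_1,\dots,x_m$. Let $(S_n)_{n\ge0}$ be the simple symmetric random walk on $\mathbb Z$, with law $P^0$ and expectation $E^0$ when it starts at $0$. For a trajectory let $\tau_y=\inf\{n\ge0: S_n=y\}$ and let $\tau_0^{(2)}$ be the time of its second visit to $0$ (with $\inf\emptyset=\infty$). For $y\ge1$ let $Q_y$ be the probability measure on environments and paths given by $$Q_y(A)=\frac{\mathbb E E^0\big(\mathbf 1_{\{\tau_y<\infty\}}\mathbf 1_A\,e^{-\sum_{n=0}^{\tau_y-1}V(S_n,\omega)}\big)}{\mathbb E E^0\big(\mathbf 1_{\{\tau_y<\infty\}}\,e^{-\sum_{n=0}^{\tau_y-1}V(S_n,\omega)}\big)}.$$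 Given $\omega$, the killed random walk is the Markov chain on $\mathbb Z\cup\{\dagger\}$, with $\dagger$ absorbing, which from $z\in\mathbb Z$ goes to $\dagger$ with probability $1-e^{-V(z,\omega)}$ and otherwise to $z+1$ or $z-1$ with equal probabilities. Let $\check P$ be the joint law of the environment and of the killed random walk started at $0$, averaged over $\mathbb P$, and for $y\ge 1$ let $Q_{0,y}(\cdot)=\check P(\,\cdot\mid \tau_0^{(2)}>\tau_y,\ \tau_y<\infty)$. Then there exist constants $M_1,M_2$ and $\theta\in(0,1)$, not depending on $m$, $a$, $b$, $y$ or $x_1,\dots,x_m$, such that for all $m\ge0$ and all integers $0\le a=x_0<x_1<\dots<x_m<x_{m+1}=b\le y$ $$Q_{0,y}\big(\Omega_{(a,b)}(x_1,\dots,x_m)\big)\le\prod_{j=0}^m\big(M_1\theta^{x_{j+1}-x_j}\big),\qquad Q_y\big(\Omega_{(a,b)}(x_1,\dots,x_m)\big)\le\prod_{j=0}^m\big(M_2\theta^{x_{j+1}-x_j}\big).$$ -/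

import Mathlib

open MeasureTheory ProbabilityTheory
open scoped ENNReal NNReal

noncomputable section

namespace RandomPotential

/-! ### Markov chains on a countable state space -/

section Chain

variable {S : Type*} [MeasurableSpace S]

/-- The one-step kernels of a time-homogeneous Markov chain: the next state is drawn from the
transition kernel at the present state. -/
def stepKernel (p : Kernel S S) (n : ℕ) : Kernel (Finset.Iic n → S) S :=
  p.comap (fun h => h ⟨n, Finset.mem_Iic.2 le_rfl⟩) (by fun_prop)

instance (p : Kernel S S) [IsMarkovKernel p] (n : ℕ) : IsMarkovKernel (stepKernel p n) := by
  unfold stepKernel; infer_instance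

/-- The law, on the space of trajectories, of the Markov chain with transition kernel `p` and
initial state `x`. -/
def chainLaw (p : Kernel S S) [IsMarkovKernel p] (x : S) : Measure (ℕ → S) :=
  Kernel.trajMeasure (X := fun _ => S) (Measure.dirac x) (stepKernel p)

instance (p : Kernel S S) [IsMarkovKernel p] (x : S) : IsProbabilityMeasure (chainLaw p x) := by
  unfold chainLaw; infer_instance

variable [Countable S] [DiscreteMeasurableSpace S]

theorem chainLaw_zero (p : Kernel S S) [IsMarkovKernel p] (x : S) (w : ℕ → S) :
    chainLaw p x {s | ∀ i ≤ 0, s i = w i} = Measure.dirac x {w 0} := by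
  have h0 : {s : ℕ → S | ∀ i ≤ 0, s i = w i} =
      Preorder.frestrictLe (π := fun _ => S) 0 ⁻¹' {h | h ⟨0, by simp⟩ = w 0} := by
    ext s; simp
  have hm : MeasurableSet {h : Finset.Iic 0 → S | h ⟨0, by simp⟩ = w 0} :=
    measurableSet_eq_fun (by fun_prop) measurable_const
  rw [h0, ← Measure.map_apply (by fun_prop) hm, chainLaw, Kernel.trajMeasure,
    Measure.map_comp _ _ (by fun_prop), Kernel.traj_map_frestrictLe, Kernel.partialTraj_self,
    Measure.id_comp, Measure.map_apply (by fun_prop) hm]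
  rfl

theorem chainLaw_succ (p : Kernel S S) [IsMarkovKernel p] (x : S) (w : ℕ → S) (n : ℕ) :
    chainLaw p x {s | ∀ i ≤ n + 1, s i = w i} =
      chainLaw p x {s | ∀ i ≤ n, s i = w i} * p (w n) {w (n + 1)} := by
  set h₀ : Finset.Iic n → S := fun i => w i
  have e1 : {s : ℕ → S | ∀ i ≤ n, s i = w i} =
      Preorder.frestrictLe (π := fun _ => S) n ⁻¹' {h₀} := by
    ext s
    simp [h₀, funext_iff, Preorder.frestrictLe]
  have e2 : {s : ℕ → S | ∀ i ≤ n + 1, s i = w i} =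
      (fun s : ℕ → S => (Preorder.frestrictLe (π := fun _ => S) n s, s (n + 1))) ⁻¹'
        ({h₀} ×ˢ {w (n + 1)}) := by
    ext s
    simp only [Set.mem_ofPred_eq, Set.mem_preimage, Set.mem_prod, Set.mem_singleton_iff,
      Nat.le_succ_iff]
    constructor
    · intro h
      refine ⟨?_, h _ (Or.inr rfl)⟩
      funext i
      exact h _ (Or.inl (Finset.mem_Iic.1 i.2))
    · rintro ⟨h1, h2⟩ i (hi | rfl)
      · exact congrFun h1 ⟨i, Finset.mem_Iic.2 hi⟩
      · exact h2
  have hm : MeasurableSet ({h₀} ×ˢ {w (n + 1)} : Set ((Finset.Iic n → S) × S)) :=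
    (measurableSet_singleton _).prod (measurableSet_singleton _)
  rw [e2, ← Measure.map_apply (by fun_prop) hm, chainLaw,
    ← Kernel.map_frestrictLe_trajMeasure_compProd_eq_map_trajMeasure,
    Measure.compProd_apply_prod (measurableSet_singleton _) (measurableSet_singleton _),
    Measure.restrict_singleton, lintegral_smul_measure, lintegral_dirac,
    Measure.map_apply (by fun_prop) (measurableSet_singleton _), e1]
  rfl

/-- The probability that a Markov chain follows a given finite trajectory. -/
theorem chainLaw_cylinder (p : Kernel S S) [IsMarkovKernel p] (x : S) (w : ℕ → S) (n : ℕ) :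
    chainLaw p x {s | ∀ i ≤ n, s i = w i} =
      Measure.dirac x {w 0} * ∏ i ∈ Finset.range n, p (w i) {w (i + 1)} := by
  induction n with
  | zero => rw [chainLaw_zero, Finset.range_zero, Finset.prod_empty, mul_one]
  | succ n ih => rw [chainLaw_succ, ih, Finset.prod_range_succ, mul_assoc]

/-- If the transition probabilities depend measurably on a parameter, so does the law of the
chain. -/
theorem measurable_chainLaw {Ω : Type*} [MeasurableSpace Ω] (p : Ω → Kernel S S)
    [∀ ω, IsMarkovKernel (p ω)] (hp : ∀ s t, Measurable fun ω => p ω s {t}) (x : S) :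
    Measurable fun ω => chainLaw (p ω) x := by
  refine Measurable.measure_of_isPiSystem_of_isProbabilityMeasure
    (generateFrom_measurableCylinders (α := fun _ : ℕ => S)).symm
    (isPiSystem_measurableCylinders (α := fun _ : ℕ => S)) ?_
  intro A hA
  obtain ⟨I, B, hB, rfl⟩ := (mem_measurableCylinders (α := fun _ : ℕ => S) _).1 hA
  have hI : I ⊆ Finset.Iic (I.sup id) := fun i hi => Finset.mem_Iic.2 (Finset.le_sup (f := id) hi)
  set n := I.sup id
  set C : Set (Finset.Iic n → S) := (fun h i => h ⟨i.1, hI i.2⟩) ⁻¹' B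
  have hC : MeasurableSet C := hB.preimage (by fun_prop)
  have e : cylinder (α := fun _ : ℕ => S) I B = Preorder.frestrictLe (π := fun _ => S) n ⁻¹' C := by
    ext s; rfl
  have key : ∀ ω, chainLaw (p ω) x (cylinder I B) =
      ∑' h, C.indicator (fun h => ((chainLaw (p ω) x).map
        (Preorder.frestrictLe (π := fun _ => S) n)) {h}) h := by
    intro ω
    rw [Measure.tsum_indicator_apply_singleton _ C hC, Measure.map_apply (by fun_prop) hC, e]
  simp_rw [key]
  refine Measurable.tsum fun h => ?_
  by_cases hh : h ∈ C
  swap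
  · simp [hh]
  simp only [Set.indicator_of_mem hh]
  set w : ℕ → S := fun i => if hi : i ≤ n then h ⟨i, Finset.mem_Iic.2 hi⟩ else x
  have ew : Preorder.frestrictLe (π := fun _ => S) n ⁻¹' {h} = {s | ∀ i ≤ n, s i = w i} := by
    ext s
    simp only [Set.mem_preimage, Set.mem_singleton_iff, Set.mem_ofPred_eq]
    constructor
    · rintro rfl i hi
      simp [w, hi]
    · intro hs
      funext i
      have := hs i (Finset.mem_Iic.1 i.2)
      simpa [w, Finset.mem_Iic.1 i.2] using this
  have ec : ∀ ω, ((chainLaw (p ω) x).map (Preorder.frestrictLe (π := fun _ => S) n)) {h} =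
      Measure.dirac x {w 0} * ∏ i ∈ Finset.range n, p ω (w i) {w (i + 1)} := by
    intro ω
    rw [Measure.map_apply (by fun_prop) (measurableSet_singleton _), ew, chainLaw_cylinder]
  simp_rw [ec]
  exact (Finset.measurable_prod _ fun i _ => hp _ _).const_mul _

/-- The time of the first visit of the trajectory `s` to `z`; it is `⊤` if there is none. -/
def hitTime {S : Type*} (s : ℕ → S) (z : S) : ℕ∞ :=
  ⨅ (n : ℕ) (_ : s n = z), (n : ℕ∞)

/-- The time of the second visit of the trajectory `s` to `z`; it is `⊤` if there is none. -/
def secondHitTime {S : Type*} (s : ℕ → S) (z : S) : ℕ∞ :=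
  ⨅ (n : ℕ) (_ : hitTime s z < n ∧ s n = z), (n : ℕ∞)

end Chain

/-! ### Simple random walk and the weighted path measure -/

/-- `e^{-v}` for `v ∈ [0, ∞]`, with `e^{-∞} = 0`. -/
def expNeg (v : ℝ≥0∞) : ℝ≥0∞ := EReal.exp (-(v : EReal))

/-- The transition kernel of the simple symmetric random walk on `ℤ`. -/
def srwKernel : Kernel ℤ ℤ :=
  Kernel.ofFunOfCountable fun z =>
    (2⁻¹ : ℝ≥0∞) • Measure.dirac (z + 1) + (2⁻¹ : ℝ≥0∞) • Measure.dirac (z - 1)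

instance : IsMarkovKernel srwKernel := by
  refine ⟨fun z => ⟨?_⟩⟩
  simp [srwKernel, Kernel.ofFunOfCountable, ENNReal.inv_two_add_inv_two]

/-- The law of the simple symmetric random walk on `ℤ` started at `x`. -/
def srw (x : ℤ) : Measure (ℕ → ℤ) := chainLaw srwKernel x

variable {Ω : Type*} [MeasurableSpace Ω]

open Classical in
/-- The weight `1_{τ_y < ∞} exp (-∑_{n < τ_y} V (S_n, ω))`. -/
def weight (V : ℤ → Ω → ℝ≥0∞) (y : ℤ) (q : Ω × (ℕ → ℤ)) : ℝ≥0∞ :=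
  if hitTime q.2 y < ⊤ then
    expNeg (∑ n ∈ Finset.range (hitTime q.2 y).toNat, V (q.2 n) q.1)
  else 0

/-- The unnormalized annealed measure on environments and paths. -/
def weightedMeasure (P : Measure Ω) (V : ℤ → Ω → ℝ≥0∞) (x y : ℤ) : Measure (Ω × (ℕ → ℤ)) :=
  (P.prod (srw x)).withDensity (weight V y)

/-- The annealed path measure `Q^x_y`, as a measure on environments and paths; the normalizing
constant is the annealed partition function `Z^x_y = 𝔼 Z^{ω,x}_y`. -/
def annealedQ (P : Measure Ω) (V : ℤ → Ω → ℝ≥0∞) (x y : ℤ) : Measure (Ω × (ℕ → ℤ)) :=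
  (weightedMeasure P V x y Set.univ)⁻¹ • weightedMeasure P V x y

/-! ### The killed random walk -/

/-- The state space `ℤ ∪ {†}` of the killed walk, with `†` represented by `none`, is discrete. -/
instance : MeasurableSpace (Option ℤ) := ⊤

instance : DiscreteMeasurableSpace (Option ℤ) := ⟨fun _ => trivial⟩

/-- One step of the killed walk in the potential `v`: from `z` the walk goes to the absorbing
state with probability `1 - e^{-v z}`, and otherwise to one of the two neighbours of `z` with
equal probabilities. -/
def killedStep (v : ℤ → ℝ≥0∞) : Option ℤ → Measure (Option ℤ)
  | none => Measure.dirac none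
  | some z => (1 - expNeg (v z)) • Measure.dirac none +
      expNeg (v z) • ((2⁻¹ : ℝ≥0∞) • Measure.dirac (some (z + 1)) +
        (2⁻¹ : ℝ≥0∞) • Measure.dirac (some (z - 1)))

/-- The transition kernel of the killed walk in the potential `v`. -/
def killedKernel (v : ℤ → ℝ≥0∞) : Kernel (Option ℤ) (Option ℤ) :=
  Kernel.ofFunOfCountable (killedStep v)

theorem expNeg_le_one (v : ℝ≥0∞) : expNeg v ≤ 1 := by
  rw [expNeg, ← EReal.exp_zero]
  exact EReal.exp_monotone (by simpa using EReal.coe_ennreal_nonneg v)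

theorem measurable_expNeg : Measurable expNeg := by
  unfold expNeg
  fun_prop

instance (v : ℤ → ℝ≥0∞) : IsMarkovKernel (killedKernel v) := by
  refine ⟨fun s => ⟨?_⟩⟩
  cases s with
  | none => simp [killedKernel, killedStep, Kernel.ofFunOfCountable]
  | some z =>
    simp [killedKernel, killedStep, Kernel.ofFunOfCountable]
    rw [← mul_add, ENNReal.inv_two_add_inv_two, mul_one, tsub_add_cancel_of_le (expNeg_le_one _)]

/-- The quenched law of the killed walk started at `x`, as a function of the environment. -/
def killedWalk (V : ℤ → Ω → ℝ≥0∞) (hV : ∀ z, Measurable (V z)) (x : ℤ) :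
    Kernel Ω (ℕ → Option ℤ) where
  toFun ω := chainLaw (killedKernel fun z => V z ω) (some x)
  measurable' := by
    refine measurable_chainLaw (fun ω => killedKernel fun z => V z ω) (fun s t => ?_) _
    cases s with
    | none => exact measurable_const
    | some z =>
      have h : Measurable fun ω => expNeg (V z ω) := measurable_expNeg.comp (hV z)
      simp only [killedKernel, killedStep, Kernel.ofFunOfCountable, Kernel.coe_mk,
        Measure.add_apply, Measure.smul_apply, smul_eq_mul]
      fun_prop

instance (V : ℤ → Ω → ℝ≥0∞) (hV : ∀ z, Measurable (V z)) (x : ℤ) :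
    IsMarkovKernel (killedWalk V hV x) :=
  ⟨fun ω => inferInstanceAs
    (IsProbabilityMeasure (chainLaw (killedKernel fun z => V z ω) (some x)))⟩

/-- The averaged law of the killed walk started at `x`, as a measure on environments and
trajectories. -/
def killedAveraged (P : Measure Ω) (V : ℤ → Ω → ℝ≥0∞) (hV : ∀ z, Measurable (V z)) (x : ℤ) :
    Measure (Ω × (ℕ → Option ℤ)) :=
  P ⊗ₘ killedWalk V hV x

/-- The measure `Q_{x,y}`: the averaged killed walk started at `x`, conditioned on hitting `y`
before its second visit to `x`. -/
def bridgeQ (P : Measure Ω) (V : ℤ → Ω → ℝ≥0∞) (hV : ∀ z, Measurable (V z)) (x y : ℤ) :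
    Measure (Ω × (ℕ → Option ℤ)) :=
  ProbabilityTheory.cond (killedAveraged P V hV x)
    {q | hitTime q.2 (some y) < secondHitTime q.2 (some x) ∧ hitTime q.2 (some y) < ⊤}

/-! ### Reasonable sites -/

/-- The event that, among the sites of `I`, exactly those of `X ⊆ I` are reasonable, that is,
carry a potential in `[κ, K]`. -/
def reasonableExactly (V : ℤ → Ω → ℝ≥0∞) (κ K : ℝ≥0) (I X : Set ℤ) : Set Ω :=
  {ω | (∀ z ∈ X, V z ω ∈ Set.Icc (κ : ℝ≥0∞) K) ∧
    ∀ z ∈ I \ X, V z ω ∉ Set.Icc (κ : ℝ≥0∞) K}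

end RandomPotential

end

/-!
A path from `0` to `y` is a *bridge* if it does not return to `0`. The quenched weight of the
bridges is a product of one-site crossing ratios `r_{k+1} = e / (1 - e r_k)`, where `e ≤ 1/2` is
the weight of a step out of the site. Comparing these ratios shows that the weight is
supermultiplicative under concatenation, and conversely that a bridge splits at the site at
distance `l` from its start at a cost `2 l`, and at a reasonable site at a bounded cost `g`.

Let `b n` be the annealed weight of the bridges of length `n`, and `h l` that of the bridges of
length `l` to a reasonable site with no reasonable site in between. Decomposing at the first
reasonable site gives `∑ l, q * h l * b (n - l) ≤ b n` with `q > 0`, while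
`h (l + L) ≤ 2 l * h l * h L`. As the harmonic series diverges, this forces `h l ≤ M θ ^ l * b l`
for some `θ < 1`: a gap between reasonable sites is exponentially unlikely. Splitting a bridge at
all the reasonable sites gives the bound for `Q_{0,y}`. The bound for `Q_y` follows because the
free partition function is at most `g + 2 k` times the bridge weight when the first reasonable
site to the left of `0` is at distance `k + 1`, which has geometric tails.
-/

noncomputable section

namespace RandomPotential

/-! ### Crossing weights of nearest-neighbour paths -/

section Crossing

/-- The weights `e z` of a step out of `z`, in either direction, of a nearest-neighbour walk with
killing: with probability `1 - 2 * e z` the walk is killed at `z`. -/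
def IsStepWeight (e : ℤ → ℝ) : Prop :=
  ∀ z, e z ∈ Set.Icc 0 (1 / 2)

/-- The weight of crossing from `x + k` to `x + k + 1`, when the weight of crossing from `x` to
`x + 1` is `t` and a step out of `z`, in either direction, has weight `e z`. -/
def crossRatio (e : ℤ → ℝ) (t : ℝ) (x : ℤ) : ℕ → ℝ
  | 0 => t
  | k + 1 => e (x + k + 1) / (1 - e (x + k + 1) * crossRatio e t x k)

/-- The factors of `bridge`: after the first step, the crossing weights of the walk that is killed
at `x`. -/
def bridgeFactor (e : ℤ → ℝ) (x : ℤ) : ℕ → ℝ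
  | 0 => e x
  | k + 1 => crossRatio e 0 x (k + 1)

/-- The total weight of the paths that go from `x` to `x + n` without returning to `x`. -/
def bridge (e : ℤ → ℝ) (x : ℤ) (n : ℕ) : ℝ :=
  ∏ k ∈ Finset.range n, bridgeFactor e x k

variable {a r s C : ℝ}

theorem step_denom_pos (ha : a ∈ Set.Icc 0 (1 / 2)) (hr : r < 1) : 0 < 1 - a * r := by
  nlinarith [ha.1, ha.2]

theorem step_ratio_mem (ha : a ∈ Set.Icc 0 (1 / 2)) (hr : r < 1) :
    a / (1 - a * r) ∈ Set.Ico 0 1 := by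
  have d := step_denom_pos ha hr
  refine ⟨div_nonneg ha.1 d.le, (div_lt_one d).2 ?_⟩
  rcases ha.1.eq_or_lt with rfl | ha0
  · norm_num
  · nlinarith [mul_pos ha0 (sub_pos.2 hr), ha.2]

theorem step_ratio_mono (ha : a ∈ Set.Icc 0 (1 / 2)) (hs : s < 1) (hrs : r ≤ s) :
    a / (1 - a * r) ≤ a / (1 - a * s) := by
  have := step_denom_pos ha hs
  have := ha.1
  gcongr

theorem step_ratio_le_escape (ha : a ∈ Set.Icc 0 (1 / 2)) (hr : r < 1)
    (hC : 1 ≤ C * (1 - a * (1 + r))) :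
    a / (1 - a * r) ≤ C * a * (1 - a / (1 - a * r)) := by
  have d := step_denom_pos ha hr
  have : C * a * (1 - a / (1 - a * r)) = a / (1 - a * r) * (C * (1 - a * (1 + r))) := by
    field_simp
    ring
  rw [this]
  exact le_mul_of_one_le_right (step_ratio_mem ha hr).1 hC

theorem one_le_two_mul_escape {L : ℝ} (ha : a ∈ Set.Icc 0 (1 / 2)) (hL : 0 < L) (hr0 : 0 ≤ r)
    (hr : r ≤ 1 - 1 / L) : 1 ≤ 2 * L * (1 - a * (1 + r)) := by
  have h : a * (1 + r) ≤ 1 / 2 * (1 + (1 - 1 / L)) := by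
    have := ha.2
    gcongr
  calc (1 : ℝ) = 2 * L * (1 - 1 / 2 * (1 + (1 - 1 / L))) := by field_simp; ring
    _ ≤ 2 * L * (1 - a * (1 + r)) := by gcongr

theorem le_of_mul_one_sub_le {N D : ℝ} (hD : 0 ≤ D) (hs : s < 1) (hsr : s ≤ r)
    (h : N * (1 - s) ≤ D * (1 - r)) : N ≤ D := by
  refine le_of_mul_le_mul_right (h.trans ?_) (sub_pos.2 hs)
  gcongr

theorem mul_step_ratio_mul_one_sub_le {N D : ℝ} (ha : a ∈ Set.Icc 0 (1 / 2)) (hr : r < 1)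
    (hs : s < 1) (hND : N ≤ D) (h : N * (1 - s) ≤ D * (1 - r)) :
    N * (a / (1 - a * r)) * (1 - a / (1 - a * s)) ≤
      D * (a / (1 - a * s)) * (1 - a / (1 - a * r)) := by
  have d₁ := step_denom_pos ha hr
  have d₂ := step_denom_pos ha hs
  have ha₀ := ha.1
  have ha₁ : 0 ≤ 1 - 2 * a := by linarith [ha.2]
  calc N * (a / (1 - a * r)) * (1 - a / (1 - a * s))
      = a / ((1 - a * r) * (1 - a * s)) * (N * (1 - 2 * a) + a * (N * (1 - s))) := by
        field_simp
        ring
    _ ≤ a / ((1 - a * r) * (1 - a * s)) * (D * (1 - 2 * a) + a * (D * (1 - r))) := by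
        gcongr
    _ = D * (a / (1 - a * s)) * (1 - a / (1 - a * r)) := by
        field_simp
        ring

theorem ratio_le_of_killing {g : ℝ} (ha : a ∈ Set.Icc 0 (1 / 2)) (hg : 0 < g)
    (h : 1 ≤ g * (1 - 2 * a)) : a / (1 - a) ≤ 1 - 1 / g := by
  have hga : 1 / g ≤ 1 - 2 * a := by rwa [div_le_iff₀' hg]
  rw [div_le_iff₀ (by linarith [ha.2])]
  nlinarith [ha.1, one_div_pos.2 hg]

variable {e : ℤ → ℝ} {t : ℝ}

theorem crossRatio_mem (he : IsStepWeight e) (ht : t ∈ Set.Ico 0 1) (x : ℤ) (k : ℕ) :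
    crossRatio e t x k ∈ Set.Ico 0 1 := by
  induction k with
  | zero => exact ht
  | succ k ih => exact step_ratio_mem (he _) ih.2

theorem crossRatio_zero_mem (he : IsStepWeight e) (x : ℤ) (k : ℕ) :
    crossRatio e 0 x k ∈ Set.Ico 0 1 :=
  crossRatio_mem he ⟨le_rfl, one_pos⟩ x k

theorem crossRatio_mono (he : IsStepWeight e) (hs : 0 ≤ s) (hst : s ≤ t) (ht : t < 1) (x : ℤ)
    (k : ℕ) : crossRatio e s x k ≤ crossRatio e t x k := by
  induction k with
  | zero => exact hst
  | succ k ih => exact step_ratio_mono (he _) (crossRatio_mem he ⟨hs.trans hst, ht⟩ x k).2 ih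

theorem crossRatio_add (t : ℝ) (x : ℤ) (a k : ℕ) :
    crossRatio e t x (a + k) = crossRatio e (crossRatio e t x a) (x + a) k := by
  induction k with
  | zero => rfl
  | succ k ih =>
    rw [← add_assoc, crossRatio, crossRatio, ih]
    push_cast
    rw [add_assoc x (a : ℤ)]

/-- The bound is attained by the walk without killing, for which `1 / (1 - r)` grows by `1` at
each step. -/
theorem crossRatio_le (he : IsStepWeight e) {l : ℝ} (hl : 0 < l) (ht0 : 0 ≤ t)
    (ht : t ≤ 1 - 1 / l) (x : ℤ) (k : ℕ) : crossRatio e t x k ≤ 1 - 1 / (l + k) := by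
  have hl' : 0 < 1 / l := by positivity
  induction k with
  | zero => simpa [crossRatio] using ht
  | succ k ih =>
    have hr := crossRatio_mem he ⟨ht0, by linarith⟩ x k
    have ha := he (x + k + 1)
    rw [crossRatio]
    set r := crossRatio e t x k
    set a := e (x + k + 1)
    have hrl : r * (l + k) ≤ l + k - 1 := by
      calc r * (l + k) ≤ (1 - 1 / (l + k)) * (l + k) := by gcongr
        _ = l + k - 1 := by field_simp
    have hsucc : 1 - 1 / (l + (k + 1 : ℕ)) = (l + k) / (l + k + 1) := by
      push_cast
      field_simp
      ring
    rw [hsucc, div_le_div_iff₀ (step_denom_pos ha hr.2) (by positivity)]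
    nlinarith [ha.1, ha.2]

theorem bridge_succ (e : ℤ → ℝ) (x : ℤ) (n : ℕ) :
    bridge e x (n + 1) = bridge e x n * bridgeFactor e x n :=
  Finset.prod_range_succ _ _

theorem bridgeFactor_mem (he : IsStepWeight e) (x : ℤ) (k : ℕ) :
    bridgeFactor e x k ∈ Set.Ico 0 1 := by
  cases k with
  | zero => exact ⟨(he x).1, (he x).2.trans_lt (by norm_num)⟩
  | succ k => exact crossRatio_zero_mem he x (k + 1)

theorem bridge_nonneg (he : IsStepWeight e) (x : ℤ) (n : ℕ) : 0 ≤ bridge e x n :=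
  Finset.prod_nonneg fun k _ => (bridgeFactor_mem he x k).1

theorem bridgeFactor_add_ge (he : IsStepWeight e) (x : ℤ) (a k : ℕ) :
    bridgeFactor e (x + a) k ≤ bridgeFactor e x (a + k) := by
  cases a with
  | zero => simp
  | succ a =>
    cases k with
    | zero =>
      have hm := crossRatio_zero_mem he x a
      simpa [bridgeFactor, crossRatio, add_assoc] using
        step_ratio_mono (he (x + a + 1)) hm.2 hm.1
    | succ k =>
      have hm := crossRatio_zero_mem he x (a + 1)
      rw [bridgeFactor, ← add_assoc, bridgeFactor, add_assoc (a + 1) k 1,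
        crossRatio_add 0 x (a + 1)]
      exact crossRatio_mono he le_rfl hm.1 hm.2 _ _

theorem bridge_mul_le (he : IsStepWeight e) (x : ℤ) (a b : ℕ) :
    bridge e x a * bridge e (x + a) b ≤ bridge e x (a + b) := by
  rw [bridge, bridge, bridge, Finset.prod_range_add]
  exact mul_le_mul_of_nonneg_left
    (Finset.prod_le_prod (fun k _ => (bridgeFactor_mem he _ k).1)
      fun k _ => bridgeFactor_add_ge he x a k)
    (bridge_nonneg he x a)

theorem prod_crossRatio_mul_le (he : IsStepWeight e) {x : ℤ} (ht : t ∈ Set.Ico 0 1) (hC0 : 0 ≤ C)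
    (hC : t ≤ C * e x * (1 - t)) (n : ℕ) :
    (∏ k ∈ Finset.range (n + 1), crossRatio e t x k) * (1 - crossRatio e 0 x n) ≤
      C * bridge e x (n + 1) * (1 - crossRatio e t x n) := by
  induction n with
  | zero => simpa [crossRatio, bridge, bridgeFactor] using hC
  | succ n ih =>
    have hle := le_of_mul_one_sub_le (mul_nonneg hC0 (bridge_nonneg he x (n + 1)))
      (crossRatio_zero_mem he x n).2 (crossRatio_mono he le_rfl ht.1 ht.2 x n) ih
    rw [Finset.prod_range_succ, bridge_succ, bridgeFactor, ← mul_assoc C]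
    exact mul_step_ratio_mul_one_sub_le (he _) (crossRatio_mem he ht x n).2
      (crossRatio_zero_mem he x n).2 hle ih

/-- Allowing returns to the starting site costs a factor `C` if `1 - t`, the escape weight there,
is large enough. -/
theorem prod_crossRatio_le (he : IsStepWeight e) {x : ℤ} (ht : t ∈ Set.Ico 0 1) (hC0 : 0 ≤ C)
    (hC : t ≤ C * e x * (1 - t)) (n : ℕ) :
    ∏ k ∈ Finset.range (n + 1), crossRatio e t x k ≤ C * bridge e x (n + 1) :=
  le_of_mul_one_sub_le (mul_nonneg hC0 (bridge_nonneg he _ _)) (crossRatio_zero_mem he x n).2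
    (crossRatio_mono he le_rfl ht.1 ht.2 x n) (prod_crossRatio_mul_le he ht hC0 hC n)

theorem bridge_add_le_of_escape (he : IsStepWeight e) (hC0 : 0 ≤ C) (x : ℤ) (a b : ℕ)
    (hC : 1 ≤ C * (1 - e (x + a + 1) * (1 + crossRatio e 0 x a))) :
    bridge e x (a + 1 + (b + 1)) ≤
      C * (bridge e x (a + 1) * bridge e (x + (a + 1 : ℕ)) (b + 1)) := by
  set t := crossRatio e 0 x (a + 1)
  have ht : t ≤ C * e (x + (a + 1 : ℕ)) * (1 - t) := by
    simpa [t, crossRatio, add_assoc] using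
      step_ratio_le_escape (he (x + a + 1)) (crossRatio_zero_mem he x a).2 hC
  have hsplit : bridge e x (a + 1 + (b + 1)) = bridge e x (a + 1) *
      ∏ k ∈ Finset.range (b + 1), crossRatio e t (x + (a + 1 : ℕ)) k := by
    rw [bridge, Finset.prod_range_add, ← bridge]
    congr 1
    refine Finset.prod_congr rfl fun k _ => ?_
    rw [← crossRatio_add, show a + 1 + k = a + k + 1 by ring, bridgeFactor]
  rw [hsplit, mul_left_comm]
  exact mul_le_mul_of_nonneg_left
    (prod_crossRatio_le he (crossRatio_zero_mem he x (a + 1)) hC0 ht b) (bridge_nonneg he _ _)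

theorem bridge_add_le (he : IsStepWeight e) (x : ℤ) {a b : ℕ} (ha : 1 ≤ a) (hb : 1 ≤ b) :
    bridge e x (a + b) ≤ 2 * a * (bridge e x a * bridge e (x + a) b) := by
  obtain ⟨a, rfl⟩ := Nat.exists_eq_add_of_le' ha
  obtain ⟨b, rfl⟩ := Nat.exists_eq_add_of_le' hb
  refine bridge_add_le_of_escape he (by positivity) x a b ?_
  have h := one_le_two_mul_escape (he (x + a + 1)) (L := 1 + a) (by positivity)
    (crossRatio_zero_mem he x a).1 (crossRatio_le he one_pos le_rfl (by norm_num) x a)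
  simpa [add_comm] using h

theorem bridge_add_le_of_killing (he : IsStepWeight e) (x : ℤ) {a b : ℕ} {g : ℝ} (hg : 0 ≤ g)
    (ha : 1 ≤ a) (hb : 1 ≤ b) (hx : 1 ≤ g * (1 - 2 * e (x + a))) :
    bridge e x (a + b) ≤ g * (bridge e x a * bridge e (x + a) b) := by
  obtain ⟨a, rfl⟩ := Nat.exists_eq_add_of_le' ha
  obtain ⟨b, rfl⟩ := Nat.exists_eq_add_of_le' hb
  refine bridge_add_le_of_escape he hg x a b (hx.trans ?_)
  have hm := crossRatio_zero_mem he x a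
  push_cast
  rw [← add_assoc]
  exact mul_le_mul_of_nonneg_left (by nlinarith [(he (x + a + 1)).1, hm.2]) hg

end Crossing

/-! ### Harmonic functions -/

section Harmonic

/-- `Z` is harmonic on `s` for the walk with step weights `e`. -/
def IsHarmonicOn (e : ℤ → ℝ) (s : Set ℤ) (Z : ℤ → ℝ) : Prop :=
  ∀ z ∈ s, Z z = e z * (Z (z - 1) + Z (z + 1))

namespace IsHarmonicOn

variable {e Z : ℤ → ℝ} {t : ℝ} {x y : ℤ}

theorem mono {s s' : Set ℤ} (hZ : IsHarmonicOn e s Z) (h : s' ⊆ s) : IsHarmonicOn e s' Z :=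
  fun z hz => hZ z (h hz)

theorem neg {s : Set ℤ} (hZ : IsHarmonicOn e s Z) : IsHarmonicOn e s (-Z) := fun z hz => by
  simp only [Pi.neg_apply]
  linarith [hZ z hz]

theorem le_crossRatio_mul (hZ : IsHarmonicOn e (Set.Ioo x y) Z) (he : IsStepWeight e)
    (ht : t ∈ Set.Ico 0 1) (hx : Z x ≤ t * Z (x + 1)) (k : ℕ) (hk : x + k < y) :
    Z (x + k) ≤ crossRatio e t x k * Z (x + k + 1) := by
  induction k with
  | zero => simpa [crossRatio] using hx
  | succ k ih =>
    push_cast at hk ⊢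
    have hprev := ih (by linarith)
    have hstep := hZ (x + k + 1) ⟨by linarith, by linarith⟩
    have d := step_denom_pos (he (x + k + 1)) (crossRatio_mem he ht x k).2
    rw [← add_assoc, crossRatio, div_mul_eq_mul_div, le_div_iff₀ d]
    rw [add_sub_cancel_right] at hstep
    nlinarith [mul_le_mul_of_nonneg_left hprev (he (x + k + 1)).1]

theorem crossRatio_mul_le (hZ : IsHarmonicOn e (Set.Ioo x y) Z) (he : IsStepWeight e)
    (ht : t ∈ Set.Ico 0 1) (hx : t * Z (x + 1) ≤ Z x) (k : ℕ) (hk : x + k < y) :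
    crossRatio e t x k * Z (x + k + 1) ≤ Z (x + k) := by
  have := hZ.neg.le_crossRatio_mul he ht (by simpa using hx) k hk
  simpa using this

theorem le_prod_crossRatio_mul (hZ : IsHarmonicOn e (Set.Ioo x y) Z) (he : IsStepWeight e)
    (ht : t ∈ Set.Ico 0 1) (hx : Z x ≤ t * Z (x + 1)) (k : ℕ) (hk : x + k ≤ y) :
    Z x ≤ (∏ i ∈ Finset.range k, crossRatio e t x i) * Z (x + k) := by
  induction k with
  | zero => simp
  | succ k ih =>
    push_cast at hk ⊢
    refine (ih (by linarith)).trans ?_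
    rw [Finset.prod_range_succ, mul_assoc, ← add_assoc]
    exact mul_le_mul_of_nonneg_left (hZ.le_crossRatio_mul he ht hx k (by linarith))
      (Finset.prod_nonneg fun i _ => (crossRatio_mem he ht x i).1)

theorem mul_eq_bridge_mul (hZ : IsHarmonicOn e (Set.Ioo x y) Z) (he : IsStepWeight e)
    (hx : Z x = 0) (k : ℕ) (hk : x + k < y) :
    e x * Z (x + 1) = bridge e x (k + 1) * Z (x + k + 1) := by
  induction k with
  | zero => simp [bridge, bridgeFactor]
  | succ k ih =>
    have ht : (0 : ℝ) ∈ Set.Ico 0 1 := ⟨le_rfl, one_pos⟩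
    rw [ih (by push_cast at hk; linarith), bridge_succ e x (k + 1), bridgeFactor, mul_assoc]
    have h := le_antisymm (hZ.le_crossRatio_mul he ht (by simp [hx]) (k + 1) hk)
      (hZ.crossRatio_mul_le he ht (by simp [hx]) (k + 1) hk)
    rw [← h, Nat.cast_add_one, add_assoc x]

theorem bridge_mul_le_apply (hZ : IsHarmonicOn e (Set.Iio y) Z) (he : IsStepWeight e)
    (hZ0 : ∀ z, 0 ≤ Z z) (n : ℕ) (hn : x + n ≤ y) : bridge e x n * Z (x + n) ≤ Z x := by
  induction n with
  | zero => simp [bridge]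
  | succ n ih =>
    push_cast at hn
    refine le_trans ?_ (ih (by linarith))
    rw [bridge_succ, mul_assoc, Nat.cast_add_one, ← add_assoc]
    refine mul_le_mul_of_nonneg_left ?_ (bridge_nonneg he _ _)
    cases n with
    | zero =>
      have hstep := hZ x (by simpa [Int.add_one_le_iff] using hn)
      have := mul_nonneg (he x).1 (hZ0 (x - 1))
      simp only [bridgeFactor, Nat.cast_zero, add_zero]
      linarith
    | succ n =>
      exact (hZ.mono fun z hz => hz.2).crossRatio_mul_le he ⟨le_rfl, one_pos⟩
        (by simpa using hZ0 x) (n + 1) (by linarith)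

/-- A decrease would propagate, by convexity, linearly to the left and contradict
boundedness. -/
theorem le_succ (hZ : IsHarmonicOn e (Set.Iio y) Z) (he : IsStepWeight e)
    (hZ01 : ∀ z, Z z ∈ Set.Icc 0 1) {z : ℤ} (hz : z < y) : Z z ≤ Z (z + 1) := by
  by_contra! hlt
  set d := Z z - Z (z + 1)
  have hd : 0 < d := sub_pos.2 hlt
  have hconvex : ∀ w, w < y → Z w - Z (w + 1) ≤ Z (w - 1) - Z w := by
    intro w hw
    have := hZ w hw
    nlinarith [(he w).2, (hZ01 (w - 1)).1, (hZ01 (w + 1)).1]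
  have hslope : ∀ k : ℕ, d ≤ Z (z - k) - Z (z - k + 1) := by
    intro k
    induction k with
    | zero => simp [d]
    | succ k ih =>
      have := hconvex (z - k) (by linarith)
      push_cast
      rw [show z - ((k : ℤ) + 1) + 1 = z - k by ring, show z - ((k : ℤ) + 1) = z - k - 1 by ring]
      linarith
  have hgrowth : ∀ k : ℕ, k * d ≤ Z (z - k + 1) := by
    intro k
    induction k with
    | zero => simpa using (hZ01 (z + 1)).1
    | succ k ih =>
      have := hslope k
      push_cast
      rw [show z - ((k : ℤ) + 1) + 1 = z - k by ring]
      linarith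
  obtain ⟨k, hk⟩ := exists_nat_gt (1 / d)
  rw [div_lt_iff₀ hd] at hk
  linarith [hgrowth k, (hZ01 (z - k + 1)).2]

theorem le_ratio_mul_succ (hZ : IsHarmonicOn e (Set.Iio y) Z) (he : IsStepWeight e)
    (hZ01 : ∀ z, Z z ∈ Set.Icc 0 1) {z : ℤ} (hz : z < y) :
    Z z ≤ e z / (1 - e z) * Z (z + 1) := by
  have hstep := hZ z hz
  have hmono := hZ.le_succ he hZ01 (z := z - 1) (by linarith)
  rw [sub_add_cancel] at hmono
  rw [div_mul_eq_mul_div, le_div_iff₀ (by linarith [(he z).2])]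
  nlinarith [(he z).1]

/-- Killing at `u` makes the escape weight at `u + (k + 1)` at least of order `1 / (g + k)`. -/
theorem le_bridge (hZ : IsHarmonicOn e (Set.Iio y) Z) (he : IsStepWeight e)
    (hZ01 : ∀ z, Z z ∈ Set.Icc 0 1) {g : ℝ} (hg : 0 < g) {u : ℤ}
    (hu : 1 ≤ g * (1 - 2 * e u)) (k n : ℕ) (hy : u + (k + 1 : ℕ) + (n + 1 : ℕ) = y) :
    Z (u + (k + 1 : ℕ)) ≤ 2 * (g + k) * bridge e (u + (k + 1 : ℕ)) (n + 1) := by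
  have huy : u < y := by omega
  set t := e u / (1 - e u)
  have ht_le : t ≤ 1 - 1 / g := ratio_le_of_killing (he u) hg hu
  have ht : t ∈ Set.Ico 0 1 :=
    ⟨div_nonneg (he u).1 (by linarith [(he u).2]), by linarith [one_div_pos.2 hg]⟩
  have hfrom : ∀ v, IsHarmonicOn e (Set.Ioo v y) Z := fun v => hZ.mono fun z hz => hz.2
  have hcross := (hfrom u).le_crossRatio_mul he ht (hZ.le_ratio_mul_succ he hZ01 huy) (k + 1)
    (by omega)
  have hs := crossRatio_mem he ht u (k + 1)
  have hprod := (hfrom _).le_prod_crossRatio_mul he hs hcross (n + 1) hy.le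
  have hescape : crossRatio e t u (k + 1) ≤
      2 * (g + k) * e (u + (k + 1 : ℕ)) * (1 - crossRatio e t u (k + 1)) := by
    have hr := crossRatio_mem he ht u k
    rw [Nat.cast_add_one, ← add_assoc]
    exact step_ratio_le_escape (he _) hr.2 (one_le_two_mul_escape (he _) (by positivity) hr.1
      (crossRatio_le he hg ht.1 ht_le u k))
  calc Z (u + (k + 1 : ℕ))
      ≤ (∏ i ∈ Finset.range (n + 1), crossRatio e (crossRatio e t u (k + 1)) (u + (k + 1 : ℕ)) i) *
          1 := hprod.trans (mul_le_mul_of_nonneg_left (hZ01 _).2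
            (Finset.prod_nonneg fun i _ => (crossRatio_mem he hs _ i).1))
    _ ≤ 2 * (g + k) * bridge e (u + (k + 1 : ℕ)) (n + 1) := by
        rw [mul_one]
        exact prod_crossRatio_le he hs (by positivity) hescape n

end IsHarmonicOn

end Harmonic

/-! ### First-step analysis -/

section FirstStep

variable {S : Type*}

/-- The trajectory that starts at `x` and then follows `s`. -/
def consPath (x : S) (s : ℕ → S) : ℕ → S
  | 0 => x
  | n + 1 => s n

theorem hitTime_eq_of_first {s : ℕ → S} {z : S} {n : ℕ} (hn : s n = z) (h : ∀ m < n, s m ≠ z) :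
    hitTime s z = n := by
  refine le_antisymm (iInf₂_le n hn) (le_iInf₂ fun m hm => ?_)
  exact_mod_cast not_lt.1 fun hlt => h m hlt hm

theorem exists_hitTime_eq {s : ℕ → S} {z : S} (h : hitTime s z ≠ ⊤) :
    ∃ n : ℕ, s n = z ∧ hitTime s z = n := by
  classical
  have hex : ∃ n, s n = z := by
    by_contra! hne
    exact h (by simp [hitTime, hne])
  exact ⟨Nat.find hex, Nat.find_spec hex,
    hitTime_eq_of_first (Nat.find_spec hex) fun m hm => Nat.find_min hex hm⟩

theorem hitTime_consPath_self (x : S) (s : ℕ → S) : hitTime (consPath x s) x = 0 :=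
  hitTime_eq_of_first (n := 0) rfl (by simp)

theorem hitTime_consPath_of_ne {x z : S} (h : x ≠ z) (s : ℕ → S) :
    hitTime (consPath x s) z = hitTime s z + 1 := by
  refine le_antisymm ?_ (le_iInf₂ fun n hn => ?_)
  · by_cases ht : hitTime s z = ⊤
    · simp [ht]
    · obtain ⟨n, hn, he⟩ := exists_hitTime_eq ht
      rw [he]
      exact_mod_cast iInf₂_le (n + 1) hn
  · cases n with
    | zero => exact absurd hn h
    | succ n =>
      have : hitTime s z ≤ n := iInf₂_le n hn
      push_cast
      gcongr

theorem secondHitTime_consPath_self (x : S) (s : ℕ → S) :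
    secondHitTime (consPath x s) x = hitTime s x + 1 := by
  refine le_antisymm ?_ (le_iInf₂ fun n hn => ?_)
  · by_cases ht : hitTime s x = ⊤
    · simp [ht]
    · obtain ⟨n, hn, he⟩ := exists_hitTime_eq ht
      have hvisit : hitTime (consPath x s) x < (n + 1 : ℕ) ∧ consPath x s (n + 1) = x :=
        ⟨by rw [hitTime_consPath_self]; simp, hn⟩
      rw [he]
      exact (iInf₂_le (n + 1) hvisit).trans_eq (Nat.cast_add_one n)
  · cases n with
    | zero => simp at hn
    | succ n =>
      have : hitTime s x ≤ n := iInf₂_le n hn.2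
      push_cast
      gcongr

theorem preimage_frestrictLe_singleton (n : ℕ) (w : ℕ → S) :
    Preorder.frestrictLe (π := fun _ => S) n ⁻¹' {Preorder.frestrictLe n w} =
      {s | ∀ i ≤ n, s i = w i} := by
  ext s
  simp [funext_iff]

theorem consPath_preimage_eq_upTo_succ (w : ℕ → S) (n : ℕ) :
    consPath (w 0) ⁻¹' {s | ∀ i ≤ n + 1, s i = w i} = {s | ∀ i ≤ n, s i = w (i + 1)} := by
  ext s
  refine ⟨fun h i hi => h (i + 1) (by omega), fun h i hi => ?_⟩
  cases i with
  | zero => rfl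
  | succ i => exact h i (by omega)

variable [MeasurableSpace S]

theorem measurable_consPath (x : S) : Measurable (consPath x) := by
  refine measurable_pi_iff.2 fun n => ?_
  cases n with
  | zero => exact measurable_const
  | succ n => exact measurable_pi_apply n

instance : BorelSpace ℕ∞ := ⟨borel_eq_top_of_countable.symm⟩

theorem measurable_iInf_natCast {T : Type*} [MeasurableSpace T] {p : ℕ → T → Prop}
    (hp : ∀ n, MeasurableSet {s | p n s}) :
    Measurable fun s => ⨅ (n : ℕ) (_ : p n s), (n : ℕ∞) := by
  classical
  refine Measurable.iInf fun n => ?_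
  simp only [iInf_eq_if]
  exact Measurable.ite (hp n) measurable_const measurable_const

variable [Countable S] [DiscreteMeasurableSpace S]

theorem measurable_hitTime (z : S) : Measurable fun s : ℕ → S => hitTime s z :=
  measurable_iInf_natCast fun n => measurableSet_eq_fun (measurable_pi_apply n) measurable_const

theorem measurable_secondHitTime (z : S) : Measurable fun s : ℕ → S => secondHitTime s z :=
  measurable_iInf_natCast fun n =>
    (measurableSet_lt (measurable_hitTime z) measurable_const).inter
      (measurableSet_eq_fun (measurable_pi_apply n) measurable_const)

theorem measurableSet_eq_upTo (w : ℕ → S) (n : ℕ) :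
    MeasurableSet {s : ℕ → S | ∀ i ≤ n, s i = w i} := by
  rw [← preimage_frestrictLe_singleton]
  exact (measurableSet_singleton _).preimage (by fun_prop)

theorem trajectory_measure_ext {μ ν : Measure (ℕ → S)} [IsProbabilityMeasure μ]
    [IsProbabilityMeasure ν]
    (h : ∀ (w : ℕ → S) (n : ℕ), μ {s | ∀ i ≤ n, s i = w i} = ν {s | ∀ i ≤ n, s i = w i}) :
    μ = ν := by
  have : Nonempty S := (nonempty_of_isProbabilityMeasure μ).map fun s => s 0
  have hmap : ∀ n, μ.map (Preorder.frestrictLe (π := fun _ => S) n) =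
      ν.map (Preorder.frestrictLe (π := fun _ => S) n) := by
    refine fun n => Measure.ext_of_singleton fun f => ?_
    obtain ⟨w, rfl⟩ : ∃ w : ℕ → S, Preorder.frestrictLe n w = f :=
      Subtype.surjective_restrict (β := fun _ => S) (fun i => i ∈ Finset.Iic n) f
    rw [Measure.map_apply (by fun_prop) (measurableSet_singleton _),
      Measure.map_apply (by fun_prop) (measurableSet_singleton _),
      preimage_frestrictLe_singleton, h]
  refine IsProjectiveLimit.unique (P := fun I => ν.map I.restrict) (fun I => ?_) fun _ => rfl
  have hI : I.restrict (π := fun _ => S) =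
      Finset.restrict₂ I.subset_Iic_sup_id ∘ Preorder.frestrictLe (I.sup id) := rfl
  rw [hI, ← Measure.map_map (by fun_prop) (by fun_prop), hmap,
    Measure.map_map (by fun_prop) (by fun_prop)]
  rfl

theorem lintegral_chainLaw_consPath (p : Kernel S S) [IsMarkovKernel p] (x : S) (w : ℕ → S)
    (n : ℕ) :
    ∫⁻ t, chainLaw p t (consPath x ⁻¹' {s | ∀ i ≤ n, s i = w i}) ∂p x =
      chainLaw p x {s | ∀ i ≤ n, s i = w i} := by
  rw [chainLaw_cylinder]
  by_cases hx : x = w 0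
  swap
  · have : consPath x ⁻¹' {s | ∀ i ≤ n, s i = w i} = ∅ :=
      Set.eq_empty_of_forall_notMem fun s h => hx (h 0 n.zero_le)
    simp [this, hx]
  subst hx
  cases n with
  | zero =>
    have : consPath (w 0) ⁻¹' {s | ∀ i ≤ 0, s i = w i} = Set.univ :=
      Set.eq_univ_of_forall fun s i hi => by rw [Nat.le_zero.1 hi]; rfl
    simp only [this]
    simp
  | succ n =>
    have hdirac : ∀ t, Measure.dirac t {w 1} = Set.indicator {w 1} (fun _ => (1 : ℝ≥0∞)) t := by
      intro t
      by_cases ht : t = w 1 <;> simp [ht]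
    simp only [consPath_preimage_eq_upTo_succ, chainLaw_cylinder p _ fun i => w (i + 1)]
    rw [lintegral_mul_const _ Measurable.of_discrete, Finset.prod_range_succ']
    simp only [zero_add, hdirac, lintegral_indicator (measurableSet_singleton _),
      setLIntegral_const]
    simp [mul_comm]

theorem chainLaw_eq_bind (p : Kernel S S) [IsMarkovKernel p] (x : S) :
    chainLaw p x = (p x).bind fun t => (chainLaw p t).map (consPath x) := by
  have hmeas : Measurable fun t => (chainLaw p t).map (consPath x) := Measurable.of_discrete
  have : IsProbabilityMeasure ((p x).bind fun t => (chainLaw p t).map (consPath x)) := by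
    refine ⟨?_⟩
    rw [Measure.bind_apply MeasurableSet.univ hmeas.aemeasurable]
    simp [Measure.map_apply (measurable_consPath x) MeasurableSet.univ]
  refine trajectory_measure_ext fun w n => ?_
  rw [Measure.bind_apply (measurableSet_eq_upTo w n) hmeas.aemeasurable]
  simp only [Measure.map_apply (measurable_consPath x) (measurableSet_eq_upTo w n)]
  exact (lintegral_chainLaw_consPath p x w n).symm

theorem lintegral_chainLaw (p : Kernel S S) [IsMarkovKernel p] (x : S) {F : (ℕ → S) → ℝ≥0∞}
    (hF : Measurable F) :
    ∫⁻ s, F s ∂chainLaw p x = ∫⁻ t, ∫⁻ s, F (consPath x s) ∂chainLaw p t ∂p x := by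
  rw [chainLaw_eq_bind, Measure.lintegral_bind (Measurable.of_discrete).aemeasurable
    hF.aemeasurable]
  simp only [lintegral_map hF (measurable_consPath x)]

theorem chainLaw_apply (p : Kernel S S) [IsMarkovKernel p] (x : S) {A : Set (ℕ → S)}
    (hA : MeasurableSet A) :
    chainLaw p x A = ∫⁻ t, chainLaw p t (consPath x ⁻¹' A) ∂p x := by
  rw [chainLaw_eq_bind, Measure.bind_apply hA (Measurable.of_discrete).aemeasurable]
  simp only [Measure.map_apply (measurable_consPath x) hA]

end FirstStep

/-! ### The killed walk -/

section Killed

variable {v : ℤ → ℝ≥0∞}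

theorem expNeg_ne_top (u : ℝ≥0∞) : expNeg u ≠ ⊤ :=
  ne_top_of_le_ne_top ENNReal.one_ne_top (expNeg_le_one u)

theorem expNeg_zero : expNeg 0 = 1 := by
  simp [expNeg]

theorem expNeg_add (a b : ℝ≥0∞) : expNeg (a + b) = expNeg a * expNeg b := by
  unfold expNeg
  rw [EReal.coe_ennreal_add, EReal.neg_add (by simp) (by simp), sub_eq_add_neg, EReal.exp_add]

/-- The weight `e^{-v z} / 2` of a step, in either direction, out of the site `z` of the potential
`v`. -/
def stepWeight (v : ℤ → ℝ≥0∞) (z : ℤ) : ℝ := (expNeg (v z)).toReal / 2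

theorem isStepWeight_stepWeight (v : ℤ → ℝ≥0∞) : IsStepWeight (stepWeight v) := fun z => by
  have h : (expNeg (v z)).toReal ≤ 1 := ENNReal.toReal_le_of_le_ofReal zero_le_one
    (by simpa using expNeg_le_one (v z))
  exact ⟨by unfold stepWeight; positivity, by unfold stepWeight; linarith⟩

theorem expNeg_mul_inv_two (v : ℤ → ℝ≥0∞) (z : ℤ) :
    expNeg (v z) * 2⁻¹ = ENNReal.ofReal (stepWeight v z) := by
  rw [stepWeight, div_eq_mul_inv, ENNReal.ofReal_mul ENNReal.toReal_nonneg,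
    ENNReal.ofReal_toReal (expNeg_ne_top _), ENNReal.ofReal_inv_of_pos two_pos]
  simp

theorem isHarmonicOn_toReal {e : ℤ → ℝ} {s : Set ℤ} {Z : ℤ → ℝ≥0∞} (he : IsStepWeight e)
    (hZ : ∀ z, Z z ≠ ⊤) (h : ∀ z ∈ s, Z z = ENNReal.ofReal (e z) * (Z (z - 1) + Z (z + 1))) :
    IsHarmonicOn e s fun z => (Z z).toReal := fun z hz => by
  beta_reduce
  rw [h z hz, ENNReal.toReal_mul, ENNReal.toReal_add (hZ _) (hZ _),
    ENNReal.toReal_ofReal (he z).1]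

theorem toReal_mem_Icc {u : ℝ≥0∞} (hu : u ≤ 1) : u.toReal ∈ Set.Icc 0 1 :=
  ⟨ENNReal.toReal_nonneg, by simpa using ENNReal.toReal_mono ENNReal.one_ne_top hu⟩

theorem lintegral_killedKernel (v : ℤ → ℝ≥0∞) (z : ℤ) {F : Option ℤ → ℝ≥0∞} (hF : F none = 0) :
    ∫⁻ t, F t ∂killedKernel v (some z) =
      ENNReal.ofReal (stepWeight v z) * (F (some (z - 1)) + F (some (z + 1))) := by
  change ∫⁻ t, F t ∂killedStep v (some z) = _
  rw [killedStep, lintegral_add_measure, lintegral_smul_measure, lintegral_smul_measure,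
    lintegral_add_measure, lintegral_smul_measure, lintegral_smul_measure, lintegral_dirac,
    lintegral_dirac, lintegral_dirac, hF, ← expNeg_mul_inv_two]
  simp only [smul_eq_mul]
  ring

theorem ae_chainLaw_eq_of_absorbing {S : Type*} [MeasurableSpace S] [Countable S]
    [DiscreteMeasurableSpace S] (p : Kernel S S) [IsMarkovKernel p] {x : S}
    (hx : p x = Measure.dirac x) : ∀ᵐ s ∂chainLaw p x, ∀ n, s n = x := by
  have h : ∀ n, ∀ᵐ s ∂chainLaw p x, ∀ i ≤ n, s i = x := fun n => by
    refine (prob_compl_eq_zero_iff (measurableSet_eq_upTo (fun _ => x) n)).2 ?_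
    rw [chainLaw_cylinder p x fun _ => x]
    simp [hx]
  filter_upwards [ae_all_iff.2 h] with s hs n using hs n n le_rfl

/-- The probability that the killed walk started at `z` visits `y`, and does so before any visit
to `0`. -/
def hitBeforeZero (v : ℤ → ℝ≥0∞) (y z : ℤ) : ℝ≥0∞ :=
  chainLaw (killedKernel v) (some z) {s | hitTime s (some y) < hitTime s (some 0)}

theorem measurableSet_hitTime_lt (y : ℤ) :
    MeasurableSet {s : ℕ → Option ℤ | hitTime s (some y) < hitTime s (some 0)} :=
  measurableSet_lt (measurable_hitTime _) (measurable_hitTime _)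

theorem hitBeforeZero_le_one (v : ℤ → ℝ≥0∞) (y z : ℤ) : hitBeforeZero v y z ≤ 1 := prob_le_one

theorem hitBeforeZero_ne_top (v : ℤ → ℝ≥0∞) (y z : ℤ) : hitBeforeZero v y z ≠ ⊤ :=
  ne_top_of_le_ne_top ENNReal.one_ne_top (hitBeforeZero_le_one v y z)

theorem chainLaw_none_hitTime_lt (v : ℤ → ℝ≥0∞) (y : ℤ) :
    chainLaw (killedKernel v) none {s | hitTime s (some y) < hitTime s (some 0)} = 0 := by
  refine measure_eq_zero_iff_ae_notMem.2 ?_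
  filter_upwards [ae_chainLaw_eq_of_absorbing (killedKernel v) (x := none) rfl] with s hnone hs
  obtain ⟨n, hn, -⟩ := exists_hitTime_eq (lt_top_of_lt hs).ne
  simp [hnone n] at hn

theorem hitBeforeZero_zero (v : ℤ → ℝ≥0∞) (y : ℤ) : hitBeforeZero v y 0 = 0 := by
  have h : consPath (some 0) ⁻¹' {s | hitTime s (some y) < hitTime s (some 0)} = ∅ := by
    ext s
    simp [hitTime_consPath_self]
  rw [hitBeforeZero, chainLaw_apply _ _ (measurableSet_hitTime_lt y), h]
  simp

theorem hitBeforeZero_self (v : ℤ → ℝ≥0∞) {y : ℤ} (hy : y ≠ 0) : hitBeforeZero v y y = 1 := by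
  have h : consPath (some y) ⁻¹' {s | hitTime s (some y) < hitTime s (some 0)} = Set.univ := by
    ext s
    simp [hitTime_consPath_self, hitTime_consPath_of_ne (Option.some_injective ℤ |>.ne hy)]
  rw [hitBeforeZero, chainLaw_apply _ _ (measurableSet_hitTime_lt y), h]
  simp

theorem hitBeforeZero_step (v : ℤ → ℝ≥0∞) {y z : ℤ} (h0 : z ≠ 0) (hy : z ≠ y) :
    hitBeforeZero v y z =
      ENNReal.ofReal (stepWeight v z) *
        (hitBeforeZero v y (z - 1) + hitBeforeZero v y (z + 1)) := by
  have h : consPath (some z) ⁻¹' {s | hitTime s (some y) < hitTime s (some 0)} =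
      {s | hitTime s (some y) < hitTime s (some 0)} := by
    ext s
    simp [hitTime_consPath_of_ne (Option.some_injective ℤ |>.ne h0),
      hitTime_consPath_of_ne (Option.some_injective ℤ |>.ne hy)]
  rw [hitBeforeZero, chainLaw_apply _ _ (measurableSet_hitTime_lt y), h,
    lintegral_killedKernel _ _ (chainLaw_none_hitTime_lt v y)]
  rfl

theorem hitBeforeZero_neg_one (v : ℤ → ℝ≥0∞) {y : ℤ} (hy : 0 ≤ y) :
    hitBeforeZero v y (-1) = 0 := by
  have hharm : IsHarmonicOn (stepWeight v) (Set.Iio 0) fun z => (hitBeforeZero v y z).toReal :=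
    isHarmonicOn_toReal (isStepWeight_stepWeight v) (hitBeforeZero_ne_top v y) fun z hz =>
      hitBeforeZero_step v (ne_of_lt hz) (lt_of_lt_of_le hz hy).ne
  have hle := hharm.le_succ (isStepWeight_stepWeight v)
    (fun z => toReal_mem_Icc (hitBeforeZero_le_one v y z)) neg_one_lt_zero
  simp only [neg_add_cancel, hitBeforeZero_zero, ENNReal.toReal_zero] at hle
  exact ((ENNReal.toReal_eq_zero_iff _).1 (hle.antisymm ENNReal.toReal_nonneg)).resolve_right
    (hitBeforeZero_ne_top v y _)

/-- The trajectories of the killed walk that hit `y` before their second visit to `0`. -/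
def bridgePaths (y : ℤ) : Set (ℕ → Option ℤ) :=
  {s | hitTime s (some y) < secondHitTime s (some 0) ∧ hitTime s (some y) < ⊤}

theorem measurableSet_bridgePaths (y : ℤ) : MeasurableSet (bridgePaths y) :=
  (measurableSet_lt (measurable_hitTime _) (measurable_secondHitTime _)).inter
    (measurableSet_lt (measurable_hitTime _) measurable_const)

theorem consPath_preimage_bridgePaths {y : ℤ} (hy : y ≠ 0) :
    consPath (some 0) ⁻¹' bridgePaths y = {s | hitTime s (some y) < hitTime s (some 0)} := by
  ext s
  simp only [bridgePaths, Set.mem_preimage, Set.mem_ofPred_eq, secondHitTime_consPath_self,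
    hitTime_consPath_of_ne (Option.some_injective ℤ |>.ne hy.symm)]
  refine ⟨fun h => by simpa using h.1, fun h => ⟨by simpa using h, ?_⟩⟩
  exact ENat.add_lt_top.2 ⟨lt_top_of_lt h, by simp⟩

/-- The weight of the bridges from `x` to `x + n`, as an extended nonnegative number. -/
def bridgeWeight (v : ℤ → ℝ≥0∞) (x : ℤ) (n : ℕ) : ℝ≥0∞ :=
  ENNReal.ofReal (bridge (stepWeight v) x n)

theorem chainLaw_bridgePaths (v : ℤ → ℝ≥0∞) (n : ℕ) :
    chainLaw (killedKernel v) (some 0) (bridgePaths (n + 1 : ℕ)) = bridgeWeight v 0 (n + 1) := by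
  have hy : ((n + 1 : ℕ) : ℤ) ≠ 0 := by positivity
  have he := isStepWeight_stepWeight v
  have hharm : IsHarmonicOn (stepWeight v) (Set.Ioo 0 (n + 1 : ℕ))
      fun z => (hitBeforeZero v (n + 1 : ℕ) z).toReal :=
    isHarmonicOn_toReal he (hitBeforeZero_ne_top v _) fun z hz =>
      hitBeforeZero_step v hz.1.ne' hz.2.ne
  have hbridge := hharm.mul_eq_bridge_mul he (by simp [hitBeforeZero_zero]) n (by simp)
  have hend : (0 + n + 1 : ℤ) = (n + 1 : ℕ) := by simp
  rw [hend, hitBeforeZero_self v hy, ENNReal.toReal_one, mul_one] at hbridge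
  rw [chainLaw_apply _ _ (measurableSet_bridgePaths _), consPath_preimage_bridgePaths hy,
    lintegral_killedKernel _ _ (chainLaw_none_hitTime_lt v _)]
  change ENNReal.ofReal (stepWeight v 0) *
    (hitBeforeZero v _ (-1) + hitBeforeZero v _ (0 + 1)) = _
  rw [hitBeforeZero_neg_one v (by positivity), zero_add (hitBeforeZero _ _ _), bridgeWeight,
    ← hbridge, ENNReal.ofReal_mul (he 0).1, ENNReal.ofReal_toReal (hitBeforeZero_ne_top v _ _)]

end Killed

/-! ### The partition function -/

section Partition

variable {Ω : Type*}

theorem weight_le_one (V : ℤ → Ω → ℝ≥0∞) (y : ℤ) (q : Ω × (ℕ → ℤ)) : weight V y q ≤ 1 := by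
  unfold weight
  split_ifs
  · exact expNeg_le_one _
  · exact zero_le

theorem weight_consPath_self (V : ℤ → Ω → ℝ≥0∞) (y : ℤ) (ω : Ω) (s : ℕ → ℤ) :
    weight V y (ω, consPath y s) = 1 := by
  simp [weight, hitTime_consPath_self, expNeg_zero]

theorem weight_consPath_of_ne (V : ℤ → Ω → ℝ≥0∞) {x y : ℤ} (h : x ≠ y) (ω : Ω) (s : ℕ → ℤ) :
    weight V y (ω, consPath x s) = expNeg (V x ω) * weight V y (ω, s) := by
  unfold weight
  simp only [hitTime_consPath_of_ne h]
  by_cases ht : hitTime s y = ⊤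
  · simp [ht]
  · obtain ⟨n, -, hn⟩ := exists_hitTime_eq ht
    have hcast : ((n : ℕ∞) + 1) = ((n + 1 : ℕ) : ℕ∞) := by push_cast; rfl
    rw [hn, hcast]
    simp only [ENat.natCast_lt_top, if_true, ENat.toNat_natCast]
    rw [Finset.sum_range_succ', add_comm, expNeg_add]
    rfl

theorem measurable_weight [MeasurableSpace Ω] {V : ℤ → Ω → ℝ≥0∞} (hV : ∀ z, Measurable (V z))
    (y : ℤ) : Measurable (weight V y) := by
  have hhit : Measurable fun q : Ω × (ℕ → ℤ) => hitTime q.2 y :=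
    (measurable_hitTime y).comp measurable_snd
  have hsite (n : ℕ) : Measurable fun q : Ω × (ℕ → ℤ) => V (q.2 n) q.1 := by
    have huncurry : Measurable fun r : ℤ × Ω => V r.1 r.2 :=
      measurable_from_prod_countable_right hV
    exact huncurry.comp (f := fun q : Ω × (ℕ → ℤ) => (q.2 n, q.1)) (by fun_prop)
  have htime : Measurable fun r : (Ω × (ℕ → ℤ)) × ℕ∞ =>
      expNeg (∑ n ∈ Finset.range r.2.toNat, V (r.1.2 n) r.1.1) :=
    measurable_from_prod_countable_left fun k =>
      measurable_expNeg.comp (Finset.measurable_sum (Finset.range k.toNat) fun n _ => hsite n)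
  have hweight : Measurable fun q : Ω × (ℕ → ℤ) =>
      expNeg (∑ n ∈ Finset.range (hitTime q.2 y).toNat, V (q.2 n) q.1) :=
    htime.comp (g := fun r : (Ω × (ℕ → ℤ)) × ℕ∞ =>
      expNeg (∑ n ∈ Finset.range r.2.toNat, V (r.1.2 n) r.1.1)) (f := fun q => (q, hitTime q.2 y))
      (measurable_id.prodMk hhit)
  unfold weight
  exact Measurable.ite (measurableSet_lt hhit measurable_const) hweight measurable_const

/-- The quenched partition function of the paths from `x` to `y`. -/
def partition (v : ℤ → ℝ≥0∞) (y x : ℤ) : ℝ≥0∞ :=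
  ∫⁻ s, weight (fun z (v : ℤ → ℝ≥0∞) => v z) y (v, s) ∂srw x

theorem measurable_weight_path (v : ℤ → ℝ≥0∞) (y : ℤ) :
    Measurable fun s => weight (fun z (v : ℤ → ℝ≥0∞) => v z) y (v, s) :=
  (measurable_weight (fun z => measurable_pi_apply z) y).comp measurable_prodMk_left

theorem partition_le_one (v : ℤ → ℝ≥0∞) (y x : ℤ) : partition v y x ≤ 1 := by
  have : IsProbabilityMeasure (srw x) := by unfold srw; infer_instance
  calc partition v y x ≤ ∫⁻ _, 1 ∂srw x := lintegral_mono fun s => weight_le_one _ _ _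
    _ = 1 := by simp

theorem partition_ne_top (v : ℤ → ℝ≥0∞) (y x : ℤ) : partition v y x ≠ ⊤ :=
  ne_top_of_le_ne_top ENNReal.one_ne_top (partition_le_one v y x)

theorem partition_self (v : ℤ → ℝ≥0∞) (y : ℤ) : partition v y y = 1 := by
  rw [partition, srw, lintegral_chainLaw _ _ (measurable_weight_path v y)]
  simp [weight_consPath_self]

theorem partition_step (v : ℤ → ℝ≥0∞) {x y : ℤ} (h : x ≠ y) :
    partition v y x =
      ENNReal.ofReal (stepWeight v x) * (partition v y (x - 1) + partition v y (x + 1)) := by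
  have hsrw : srwKernel x =
      (2⁻¹ : ℝ≥0∞) • Measure.dirac (x + 1) + (2⁻¹ : ℝ≥0∞) • Measure.dirac (x - 1) := rfl
  rw [partition, srw, lintegral_chainLaw _ _ (measurable_weight_path v y)]
  simp only [weight_consPath_of_ne _ h, lintegral_const_mul _ (measurable_weight_path v y)]
  rw [hsrw, lintegral_add_measure, lintegral_smul_measure, lintegral_smul_measure,
    lintegral_dirac, lintegral_dirac, ← expNeg_mul_inv_two]
  simp only [smul_eq_mul, partition, srw]
  ring

theorem isHarmonicOn_partition (v : ℤ → ℝ≥0∞) (y : ℤ) :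
    IsHarmonicOn (stepWeight v) (Set.Iio y) fun z => (partition v y z).toReal :=
  isHarmonicOn_toReal (isStepWeight_stepWeight v) (partition_ne_top v y) fun _ hz =>
    partition_step v (ne_of_lt hz)

theorem bridgeWeight_le_partition (v : ℤ → ℝ≥0∞) (n : ℕ) :
    bridgeWeight v 0 n ≤ partition v n 0 := by
  refine ENNReal.ofReal_le_of_le_toReal ?_
  have h := (isHarmonicOn_partition v n).bridge_mul_le_apply (x := 0) (isStepWeight_stepWeight v)
    (fun _ => ENNReal.toReal_nonneg) n (by simp)
  simpa [partition_self] using h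

theorem partition_le_bridgeWeight (v : ℤ → ℝ≥0∞) (n k : ℕ) {g : ℝ} (hg : 0 < g)
    (hk : 1 ≤ g * (1 - 2 * stepWeight v (-(k + 1 : ℕ)))) :
    partition v (n + 1 : ℕ) 0 ≤ ENNReal.ofReal (2 * (g + k)) * bridgeWeight v 0 (n + 1) := by
  rw [bridgeWeight, ← ENNReal.ofReal_mul (by positivity),
    ← ENNReal.ofReal_toReal (partition_ne_top v _ 0)]
  refine ENNReal.ofReal_le_ofReal ?_
  have h := (isHarmonicOn_partition v (n + 1 : ℕ)).le_bridge (isStepWeight_stepWeight v)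
    (fun z => toReal_mem_Icc (partition_le_one v _ z)) hg hk k n (by simp)
  simpa only [neg_add_cancel] using h

end Partition

/-! ### Random environments and locality -/

section Environment

theorem lintegral_mul_of_dependsOn {ι α : Type*} [MeasurableSpace α] [Nonempty α]
    {ν : Measure (ι → α)} (hν : iIndepFun (fun i (v : ι → α) => v i) ν) {F G : (ι → α) → ℝ≥0∞}
    (hF : Measurable F) (hG : Measurable G) {S T : Finset ι} (hST : Disjoint S T)
    (hFS : DependsOn F S) (hGT : DependsOn G T) :
    ∫⁻ v, F v * G v ∂ν = (∫⁻ v, F v ∂ν) * ∫⁻ v, G v ∂ν := by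
  classical
  have hfactor : ∀ (S : Finset ι) (F : (ι → α) → ℝ≥0∞), Measurable F → DependsOn F S →
      ∃ F' : (S → α) → ℝ≥0∞, Measurable F' ∧ F' ∘ S.restrict = F := by
    intro S F hF hFS
    obtain ⟨c⟩ := ‹Nonempty α›
    refine ⟨fun w => F fun i => if h : i ∈ S then w ⟨i, h⟩ else c, ?_, ?_⟩
    · refine hF.comp (measurable_pi_iff.2 fun i => ?_)
      split_ifs
      · exact measurable_pi_apply _
      · exact measurable_const
    · funext v
      refine hFS fun i hi => ?_
      simp [Finset.mem_coe.1 hi]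
  obtain ⟨F', hF', rfl⟩ := hfactor S F hF hFS
  obtain ⟨G', hG', rfl⟩ := hfactor T G hG hGT
  exact lintegral_mul_eq_lintegral_mul_lintegral_of_indepFun hF hG
    ((hν.indepFun_finset S T hST measurable_pi_apply).comp hF' hG')

/-- The law of the i.i.d. environment in which the potential of a site has law `μ`. -/
def envLaw (μ : Measure ℝ≥0∞) : Measure (ℤ → ℝ≥0∞) := Measure.infinitePi fun _ => μ

theorem map_eq_envLaw {Ω : Type*} [MeasurableSpace Ω] {P : Measure Ω} {V : ℤ → Ω → ℝ≥0∞}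
    (hV : ∀ z, Measurable (V z)) (hindep : iIndepFun V P)
    (hident : ∀ z, IdentDistrib (V z) (V 0) P P) :
    P.map (fun ω z => V z ω) = envLaw (P.map (V 0)) := by
  rw [hindep.map_fun_eq_infinitePi_map hV, envLaw]
  simp only [fun z => (hident z).map_eq]

variable {μ : Measure ℝ≥0∞} [IsProbabilityMeasure μ]

instance : IsProbabilityMeasure (envLaw μ) := by
  unfold envLaw
  infer_instance

theorem iIndepFun_envLaw : iIndepFun (fun z (v : ℤ → ℝ≥0∞) => v z) (envLaw μ) :=
  iIndepFun_infinitePi (X := fun _ u => u) fun _ => measurable_id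

theorem measurePreserving_eval_envLaw (z : ℤ) :
    MeasurePreserving (fun v : ℤ → ℝ≥0∞ => v z) (envLaw μ) μ :=
  measurePreserving_eval_infinitePi (fun _ => μ) z

theorem measurePreserving_shift (c : ℤ) :
    MeasurePreserving (fun (v : ℤ → ℝ≥0∞) z => v (c + z)) (envLaw μ) (envLaw μ) :=
  ⟨by fun_prop, Measure.map_infinitePi_infinitePi_of_inj (P := fun _ => μ)
    (add_right_injective c)⟩

theorem crossRatio_congr {e e' : ℤ → ℝ} (t : ℝ) (x : ℤ) (k : ℕ)
    (h : Set.EqOn e e' (Set.Ioc x (x + k))) : crossRatio e t x k = crossRatio e' t x k := by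
  induction k with
  | zero => rfl
  | succ k ih =>
    have hlast : e (x + k + 1) = e' (x + k + 1) := h (by push_cast; constructor <;> omega)
    rw [crossRatio, crossRatio, ih (h.mono (Set.Ioc_subset_Ioc_right (by push_cast; omega))), hlast]

theorem bridge_congr {e e' : ℤ → ℝ} (x : ℤ) (n : ℕ) (h : Set.EqOn e e' (Set.Ico x (x + n))) :
    bridge e x n = bridge e' x n := by
  refine Finset.prod_congr rfl fun k hk => ?_
  have hk := Finset.mem_range.1 hk
  cases k with
  | zero => exact h ⟨le_rfl, by omega⟩
  | succ k =>
    exact crossRatio_congr 0 x (k + 1) (h.mono fun z hz => Set.mem_Ico.2 (by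
      have := Set.mem_Ioc.1 hz
      omega))

theorem crossRatio_shift (e : ℤ → ℝ) (t : ℝ) (c x : ℤ) (k : ℕ) :
    crossRatio (fun z => e (c + z)) t x k = crossRatio e t (c + x) k := by
  induction k with
  | zero => rfl
  | succ k ih =>
    rw [crossRatio, crossRatio, ih]
    simp only [add_assoc]

theorem bridge_shift (e : ℤ → ℝ) (c x : ℤ) (n : ℕ) :
    bridge (fun z => e (c + z)) x n = bridge e (c + x) n := by
  refine Finset.prod_congr rfl fun k _ => ?_
  cases k with
  | zero => rfl
  | succ k => exact crossRatio_shift e 0 c x (k + 1)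

theorem measurable_stepWeight (z : ℤ) : Measurable fun v => stepWeight v z :=
  (measurable_expNeg.comp (measurable_pi_apply z)).ennreal_toReal.div_const 2

theorem measurable_crossRatio (t : ℝ) (x : ℤ) (k : ℕ) :
    Measurable fun v => crossRatio (stepWeight v) t x k := by
  induction k with
  | zero => exact measurable_const
  | succ k ih =>
    have := measurable_stepWeight (x + k + 1)
    simp only [crossRatio]
    fun_prop

theorem measurable_bridgeWeight (x : ℤ) (n : ℕ) : Measurable fun v => bridgeWeight v x n := by
  refine ENNReal.measurable_ofReal.comp (Finset.measurable_prod _ fun k _ => ?_)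
  cases k with
  | zero => exact measurable_stepWeight x
  | succ k => exact measurable_crossRatio 0 x (k + 1)

theorem bridgeWeight_congr {v w : ℤ → ℝ≥0∞} {x : ℤ} {n : ℕ}
    (h : Set.EqOn v w (Set.Ico x (x + n))) : bridgeWeight v x n = bridgeWeight w x n :=
  congrArg ENNReal.ofReal (bridge_congr x n fun z hz => by rw [stepWeight, stepWeight, h hz])

theorem bridgeWeight_shift (v : ℤ → ℝ≥0∞) (c x : ℤ) (n : ℕ) :
    bridgeWeight (fun z => v (c + z)) x n = bridgeWeight v (c + x) n :=
  congrArg ENNReal.ofReal (bridge_shift (stepWeight v) c x n)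

theorem bridgeWeight_mul_le (v : ℤ → ℝ≥0∞) (x : ℤ) (a b : ℕ) :
    bridgeWeight v x a * bridgeWeight v (x + a) b ≤ bridgeWeight v x (a + b) := by
  have he := isStepWeight_stepWeight v
  rw [bridgeWeight, bridgeWeight, ← ENNReal.ofReal_mul (bridge_nonneg he _ _)]
  exact ENNReal.ofReal_le_ofReal (bridge_mul_le he x a b)

theorem bridgeWeight_le_mul {v : ℤ → ℝ≥0∞} {x : ℤ} {a b : ℕ} {c : ℝ≥0}
    (h : bridge (stepWeight v) x (a + b) ≤
      c * (bridge (stepWeight v) x a * bridge (stepWeight v) (x + a) b)) :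
    bridgeWeight v x (a + b) ≤ c * (bridgeWeight v x a * bridgeWeight v (x + a) b) := by
  simpa only [bridgeWeight, ENNReal.ofReal_mul c.coe_nonneg, ENNReal.ofReal_coe_nnreal,
    ENNReal.ofReal_mul (bridge_nonneg (isStepWeight_stepWeight v) _ _)]
    using ENNReal.ofReal_le_ofReal h

theorem bridgeWeight_add_le (v : ℤ → ℝ≥0∞) (x : ℤ) {a b : ℕ} (ha : 1 ≤ a) (hb : 1 ≤ b) :
    bridgeWeight v x (a + b) ≤
      (2 * a : ℝ≥0) * (bridgeWeight v x a * bridgeWeight v (x + a) b) :=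
  bridgeWeight_le_mul (by
    push_cast
    exact bridge_add_le (isStepWeight_stepWeight v) x ha hb)

/-- The inverse of the killing probability at a site with potential `κ`: the cost of splitting a
bridge at a site whose potential is at least `κ`. -/
def killingConst (κ : ℝ≥0) : ℝ≥0 := (1 - (expNeg κ).toNNReal)⁻¹

variable {κ : ℝ≥0}

theorem expNeg_antitone : Antitone expNeg := fun _ _ h =>
  EReal.exp_monotone (EReal.neg_le_neg_iff.2 (EReal.coe_ennreal_le_coe_ennreal_iff.2 h))

theorem expNeg_toNNReal_lt_one (hκ : 0 < κ) : (expNeg κ).toNNReal < 1 := by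
  have : expNeg κ < 1 := by
    rw [expNeg, EReal.exp_lt_one_iff, EReal.neg_lt_comm]
    simpa using hκ
  exact ENNReal.toNNReal_lt_of_lt_coe this

theorem one_le_killingConst (hκ : 0 < κ) : 1 ≤ killingConst κ :=
  (one_le_inv₀ (tsub_pos_of_lt (expNeg_toNNReal_lt_one hκ))).2 tsub_le_self

theorem one_le_killingConst_mul (hκ : 0 < κ) {v : ℤ → ℝ≥0∞} {z : ℤ} (hz : κ ≤ v z) :
    1 ≤ killingConst κ * (1 - 2 * stepWeight v z) := by
  have hlt := expNeg_toNNReal_lt_one hκ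
  have hle : (expNeg (v z)).toReal ≤ (expNeg κ).toReal :=
    ENNReal.toReal_mono (expNeg_ne_top _) (expNeg_antitone hz)
  have hpos : 0 < 1 - (expNeg κ).toReal := sub_pos.2 hlt
  rw [killingConst, NNReal.coe_inv, NNReal.coe_sub hlt.le, NNReal.coe_one,
    ENNReal.coe_toNNReal_eq_toReal, inv_mul_eq_div, one_le_div hpos, stepWeight]
  linarith

theorem bridgeWeight_add_le_of_killing (hκ : 0 < κ) {v : ℤ → ℝ≥0∞} {x : ℤ} {a b : ℕ}
    (ha : 1 ≤ a) (hb : 1 ≤ b) (hv : κ ≤ v (x + a)) :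
    bridgeWeight v x (a + b) ≤ killingConst κ * (bridgeWeight v x a * bridgeWeight v (x + a) b) :=
  bridgeWeight_le_mul (bridge_add_le_of_killing (isStepWeight_stepWeight v) x
    (killingConst κ).coe_nonneg ha hb (one_le_killingConst_mul hκ hv))

end Environment

/-! ### Bridges through environments with prescribed reasonable sites -/

section Pattern

variable (κ K : ℝ≥0)

/-- The environments whose reasonable sites in `I` are exactly those of `X`. -/
abbrev envPattern (I X : Set ℤ) : Set (ℤ → ℝ≥0∞) :=
  reasonableExactly (fun z v => v z) κ K I X

variable {κ K} in
theorem mem_envPattern_congr {I X : Set ℤ} {v w : ℤ → ℝ≥0∞} (h : Set.EqOn v w (I ∪ X)) :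
    v ∈ envPattern κ K I X ↔ w ∈ envPattern κ K I X :=
  and_congr (forall₂_congr fun z hz => by simp only [h (Or.inr hz)])
    (forall₂_congr fun z hz => by simp only [h (Or.inl hz.1)])

theorem envPattern_subset {I X I' X' : Set ℤ} (hI : I' ⊆ I) (hX : X' ⊆ X) (h : I' ∩ X ⊆ X') :
    envPattern κ K I X ⊆ envPattern κ K I' X' := fun _ hv =>
  ⟨fun z hz => hv.1 z (hX hz), fun z hz => hv.2 z ⟨hI hz.1, fun hzX => hz.2 (h ⟨hz.1, hzX⟩)⟩⟩

theorem shift_mem_envPattern_iff (c : ℤ) (I X : Set ℤ) (v : ℤ → ℝ≥0∞) :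
    (fun z => v (c + z)) ∈ envPattern κ K ((c + ·) ⁻¹' I) ((c + ·) ⁻¹' X) ↔
      v ∈ envPattern κ K I X := by
  have hsurj := (Equiv.addLeft c).surjective
  exact and_congr (hsurj.forall (p := fun z => z ∈ X → v z ∈ Set.Icc (κ : ℝ≥0∞) K)).symm
    (hsurj.forall (p := fun z => z ∈ I \ X → v z ∉ Set.Icc (κ : ℝ≥0∞) K)).symm

theorem measurableSet_reasonableExactly {Ω : Type*} [MeasurableSpace Ω] {V : ℤ → Ω → ℝ≥0∞}
    (hV : ∀ z, Measurable (V z)) (I X : Set ℤ) : MeasurableSet (reasonableExactly V κ K I X) := by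
  have hset : reasonableExactly V κ K I X =
      (⋂ z ∈ X, V z ⁻¹' Set.Icc (κ : ℝ≥0∞) K) ∩ ⋂ z ∈ I \ X, (V z ⁻¹' Set.Icc (κ : ℝ≥0∞) K)ᶜ := by
    ext ω
    simp [reasonableExactly]
  rw [hset]
  exact (MeasurableSet.biInter (Set.to_countable _) fun z _ => hV z measurableSet_Icc).inter
    (MeasurableSet.biInter (Set.to_countable _) fun z _ => (hV z measurableSet_Icc).compl)

theorem measurableSet_envPattern (I X : Set ℤ) : MeasurableSet (envPattern κ K I X) :=
  measurableSet_reasonableExactly κ K measurable_pi_apply I X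

/-- The weight of the bridges from `x` to `x + n`, on the event that the reasonable sites of `I`
are those of `X`. -/
def patternBridge (I X : Set ℤ) (x : ℤ) (n : ℕ) : (ℤ → ℝ≥0∞) → ℝ≥0∞ :=
  (envPattern κ K I X).indicator fun v => bridgeWeight v x n

theorem measurable_patternBridge (I X : Set ℤ) (x : ℤ) (n : ℕ) :
    Measurable (patternBridge κ K I X x n) :=
  (measurable_bridgeWeight x n).indicator (measurableSet_envPattern κ K I X)

theorem dependsOn_patternBridge {I X : Set ℤ} {x : ℤ} {n : ℕ} (h : I ∪ X ⊆ Set.Ico x (x + n)) :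
    DependsOn (patternBridge κ K I X x n) (Finset.Ico x (x + n) : Finset ℤ) := by
  intro v w hvw
  rw [Finset.coe_Ico] at hvw
  by_cases hv : v ∈ envPattern κ K I X
  · have hw := (mem_envPattern_congr fun z hz => hvw z (h hz)).1 hv
    rw [patternBridge, Set.indicator_of_mem hv, Set.indicator_of_mem hw]
    exact bridgeWeight_congr hvw
  · have hw := mt (mem_envPattern_congr fun z hz => hvw z (h hz)).2 hv
    rw [patternBridge, Set.indicator_of_notMem hv, Set.indicator_of_notMem hw]

theorem disjoint_Ico_int (x : ℤ) (a b : ℕ) :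
    Disjoint (Finset.Ico x (x + a)) (Finset.Ico (x + a) (x + a + b)) :=
  Finset.Ico_disjoint_Ico_consecutive _ _ _

variable (μ : Measure ℝ≥0∞)

/-- The annealed weight of the bridges from `x` to `x + n`, on the event that the reasonable sites
of `I` are those of `X`. -/
def meanPatternBridge (I X : Set ℤ) (x : ℤ) (n : ℕ) : ℝ≥0∞ :=
  ∫⁻ v, patternBridge κ K I X x n v ∂envLaw μ

theorem meanPatternBridge_eq_setLIntegral (I X : Set ℤ) (x : ℤ) (n : ℕ) :
    meanPatternBridge κ K μ I X x n = ∫⁻ v in envPattern κ K I X, bridgeWeight v x n ∂envLaw μ :=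
  lintegral_indicator (measurableSet_envPattern κ K I X) _

/-- The annealed weight of the bridges over a distance `n`. -/
def meanBridge (n : ℕ) : ℝ≥0∞ := ∫⁻ v, bridgeWeight v 0 n ∂envLaw μ

/-- The annealed weight of the bridges over a distance `n` whose first `L` sites, other than the
starting point, are not reasonable. -/
def gapBridge (L n : ℕ) : ℝ≥0∞ := meanPatternBridge κ K μ (Set.Ioo 0 L) ∅ 0 n

theorem gapBridge_le_meanBridge (L n : ℕ) : gapBridge κ K μ L n ≤ meanBridge μ n :=
  lintegral_mono fun v => Set.indicator_le_self _ _ v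

variable [IsProbabilityMeasure μ]

theorem meanPatternBridge_shift (I X : Set ℤ) (c x : ℤ) (n : ℕ) :
    meanPatternBridge κ K μ ((c + ·) ⁻¹' I) ((c + ·) ⁻¹' X) x n =
      meanPatternBridge κ K μ I X (c + x) n := by
  rw [meanPatternBridge, ← (measurePreserving_shift c).lintegral_comp
    (measurable_patternBridge ..)]
  refine lintegral_congr fun v => ?_
  simp only [patternBridge, Set.indicator, bridgeWeight_shift]
  congr 1
  exact propext (shift_mem_envPattern_iff κ K c I X v)

theorem meanPatternBridge_empty_empty (x : ℤ) (n : ℕ) :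
    meanPatternBridge κ K μ ∅ ∅ x n = meanBridge μ n := by
  have h := meanPatternBridge_shift κ K μ ∅ ∅ x 0 n
  rw [add_zero] at h
  rw [← h]
  simp [meanPatternBridge, patternBridge, reasonableExactly, meanBridge]

theorem meanPatternBridge_Ioo_empty (x : ℤ) (L n : ℕ) :
    meanPatternBridge κ K μ (Set.Ioo x (x + L)) ∅ x n = gapBridge κ K μ L n := by
  have h := meanPatternBridge_shift κ K μ (Set.Ioo x (x + L)) ∅ x 0 n
  rw [add_zero] at h
  rw [← h, gapBridge, Set.preimage_const_add_Ioo, sub_self, add_sub_cancel_left, Set.preimage_empty]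

variable {κ K μ}

theorem lintegral_patternBridge_mul {I₁ X₁ I₂ X₂ : Set ℤ} {x : ℤ} {a b : ℕ}
    (h₁ : I₁ ∪ X₁ ⊆ Set.Ico x (x + a)) (h₂ : I₂ ∪ X₂ ⊆ Set.Ico (x + a) (x + a + b)) :
    ∫⁻ v, patternBridge κ K I₁ X₁ x a v * patternBridge κ K I₂ X₂ (x + a) b v ∂envLaw μ =
      meanPatternBridge κ K μ I₁ X₁ x a * meanPatternBridge κ K μ I₂ X₂ (x + a) b :=
  lintegral_mul_of_dependsOn iIndepFun_envLaw (measurable_patternBridge ..)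
    (measurable_patternBridge ..) (disjoint_Ico_int x a b) (dependsOn_patternBridge κ K h₁)
    (dependsOn_patternBridge κ K h₂)

theorem meanPatternBridge_add_le {I X I₁ X₁ I₂ X₂ : Set ℤ} {x : ℤ} {a b : ℕ} {c : ℝ≥0}
    (h₁ : I₁ ∪ X₁ ⊆ Set.Ico x (x + a)) (h₂ : I₂ ∪ X₂ ⊆ Set.Ico (x + a) (x + a + b))
    (hP : envPattern κ K I X ⊆ envPattern κ K I₁ X₁ ∩ envPattern κ K I₂ X₂)
    (hc : ∀ v ∈ envPattern κ K I X,
      bridgeWeight v x (a + b) ≤ c * (bridgeWeight v x a * bridgeWeight v (x + a) b)) :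
    meanPatternBridge κ K μ I X x (a + b) ≤
      c * (meanPatternBridge κ K μ I₁ X₁ x a * meanPatternBridge κ K μ I₂ X₂ (x + a) b) := by
  rw [← lintegral_patternBridge_mul h₁ h₂, ← lintegral_const_mul' _ _ ENNReal.coe_ne_top]
  refine lintegral_mono (Set.indicator_le fun v hv => ?_)
  rw [patternBridge, patternBridge, Set.indicator_of_mem (hP hv).1, Set.indicator_of_mem (hP hv).2]
  exact hc v hv

theorem meanPatternBridge_mul_le {I X I₁ X₁ I₂ X₂ : Set ℤ} {x : ℤ} {a b : ℕ}
    (h₁ : I₁ ∪ X₁ ⊆ Set.Ico x (x + a)) (h₂ : I₂ ∪ X₂ ⊆ Set.Ico (x + a) (x + a + b))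
    (hP : envPattern κ K I₁ X₁ ∩ envPattern κ K I₂ X₂ ⊆ envPattern κ K I X) :
    meanPatternBridge κ K μ I₁ X₁ x a * meanPatternBridge κ K μ I₂ X₂ (x + a) b ≤
      meanPatternBridge κ K μ I X x (a + b) := by
  rw [← lintegral_patternBridge_mul h₁ h₂]
  refine lintegral_mono fun v => ?_
  simp only [patternBridge]
  rw [← Set.inter_indicator_mul]
  exact (Set.indicator_le_indicator (bridgeWeight_mul_le v x a b)).trans
    (Set.indicator_le_indicator_of_subset hP (fun _ => zero_le) v)

theorem meanBridge_mul_le (a b : ℕ) :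
    meanBridge μ a * meanBridge μ b ≤ meanBridge μ (a + b) := by
  simpa only [meanPatternBridge_empty_empty] using
    meanPatternBridge_mul_le (κ := 0) (K := 0) (μ := μ) (x := 0) (a := a) (b := b)
      (I := ∅) (X := ∅) (I₁ := ∅) (X₁ := ∅) (I₂ := ∅) (X₂ := ∅) (by simp) (by simp)
      Set.inter_subset_left

theorem gapBridge_add_le {l L n : ℕ} (hl : 1 ≤ l) (hn : 1 ≤ n) (hL : L ≤ n) :
    gapBridge κ K μ (l + L) (l + n) ≤
      (2 * l : ℝ≥0) * (gapBridge κ K μ l l * gapBridge κ K μ L n) := by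
  rw [← meanPatternBridge_Ioo_empty κ K μ 0 l l, ← meanPatternBridge_Ioo_empty κ K μ (0 + l) L n]
  refine meanPatternBridge_add_le (fun z hz => ?_) (fun z hz => ?_) (Set.subset_inter ?_ ?_)
    fun v _ => bridgeWeight_add_le v 0 hl hn
  · simp only [Set.union_empty, Set.mem_Ioo, Set.mem_Ico] at hz ⊢
    omega
  · simp only [Set.union_empty, Set.mem_Ioo, Set.mem_Ico] at hz ⊢
    omega
  · refine envPattern_subset κ K (Set.Ioo_subset_Ioo le_rfl ?_) le_rfl (by simp)
    push_cast
    omega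
  · refine envPattern_subset κ K (Set.Ioo_subset_Ioo ?_ ?_) le_rfl (by simp) <;>
    · push_cast
      omega

end Pattern

/-! ### Renewal at the first reasonable site -/

section Renewal

/-- The weight of the bridges from `x` to `x + n + 1`, without the weight of their first step. -/
def bridgeTail (v : ℤ → ℝ≥0∞) (x : ℤ) (n : ℕ) : ℝ≥0∞ :=
  ENNReal.ofReal (∏ k ∈ Finset.range n, crossRatio (stepWeight v) 0 x (k + 1))

theorem bridgeWeight_succ (v : ℤ → ℝ≥0∞) (x : ℤ) (n : ℕ) :
    bridgeWeight v x (n + 1) = expNeg (v x) * 2⁻¹ * bridgeTail v x n := by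
  rw [expNeg_mul_inv_two, bridgeTail, ← ENNReal.ofReal_mul (isStepWeight_stepWeight v x).1,
    bridgeWeight, bridge, Finset.prod_range_succ', mul_comm]
  rfl

theorem measurable_bridgeTail (x : ℤ) (n : ℕ) : Measurable fun v => bridgeTail v x n :=
  ENNReal.measurable_ofReal.comp
    (Finset.measurable_prod _ fun k _ => measurable_crossRatio 0 x (k + 1))

theorem dependsOn_bridgeTail (x : ℤ) (n : ℕ) :
    DependsOn (fun v => bridgeTail v x n) (Finset.Ioc x (x + n) : Finset ℤ) := by
  intro v w h
  refine congrArg ENNReal.ofReal (Finset.prod_congr rfl fun k hk => ?_)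
  refine crossRatio_congr 0 x (k + 1) fun z hz => ?_
  have hk := Finset.mem_range.1 hk
  have hz := Set.mem_Ioc.1 hz
  rw [stepWeight, stepWeight, h z (Finset.mem_coe.2 (Finset.mem_Ioc.2 (by omega)))]

variable {κ K : ℝ≥0} {μ : Measure ℝ≥0∞} [IsProbabilityMeasure μ]

theorem lintegral_mul_bridgeTail {f : ℝ≥0∞ → ℝ≥0∞} (hf : Measurable f) (x : ℤ) (n : ℕ) :
    ∫⁻ v, f (v x) * bridgeTail v x n ∂envLaw μ =
      (∫⁻ u, f u ∂μ) * ∫⁻ v, bridgeTail v x n ∂envLaw μ := by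
  have hdep : DependsOn (fun v : ℤ → ℝ≥0∞ => f (v x)) ({x} : Finset ℤ) := fun v w h =>
    congrArg f (h x (by simp))
  have hfx : Measurable fun v : ℤ → ℝ≥0∞ => f (v x) := hf.comp (measurable_pi_apply x)
  rw [lintegral_mul_of_dependsOn iIndepFun_envLaw hfx (measurable_bridgeTail x n) (by simp) hdep
    (dependsOn_bridgeTail x n), (measurePreserving_eval_envLaw x).lintegral_comp hf]

variable (κ K μ) in
/-- A lower bound for the probability, under the annealed bridge weights, that the starting point
is reasonable. -/
def reasonableFactor : ℝ≥0∞ := expNeg K * μ (Set.Icc (κ : ℝ≥0∞) K)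

theorem reasonableFactor_mul_meanBridge_le (x : ℤ) (n : ℕ) :
    reasonableFactor κ K μ * meanBridge μ (n + 1) ≤
      meanPatternBridge κ K μ {x} {x} x (n + 1) := by
  set w : ℝ≥0∞ → ℝ≥0∞ := fun u => expNeg u * 2⁻¹
  have hw : Measurable w := measurable_expNeg.mul_const _
  have hstart : ∀ v, patternBridge κ K {x} {x} x (n + 1) v =
      (Set.Icc (κ : ℝ≥0∞) K).indicator w (v x) * bridgeTail v x n := by
    simp [patternBridge, envPattern, reasonableExactly, Set.indicator, bridgeWeight_succ, w]
  have hfree : ∀ v, patternBridge 0 0 ∅ ∅ x (n + 1) v = w (v x) * bridgeTail v x n := by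
    simp [patternBridge, envPattern, reasonableExactly, bridgeWeight_succ, w]
  have hint : reasonableFactor κ K μ * ∫⁻ u, w u ∂μ ≤
      ∫⁻ u, (Set.Icc (κ : ℝ≥0∞) K).indicator w u ∂μ := by
    calc reasonableFactor κ K μ * ∫⁻ u, w u ∂μ
        ≤ reasonableFactor κ K μ * ∫⁻ _, 2⁻¹ ∂μ := by
          gcongr
          exact mul_le_of_le_one_left' (expNeg_le_one _)
      _ = ∫⁻ _ in Set.Icc (κ : ℝ≥0∞) K, expNeg K * 2⁻¹ ∂μ := by
          simp only [reasonableFactor, lintegral_const, measure_univ, mul_one,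
            Measure.restrict_apply_univ]
          ring
      _ ≤ ∫⁻ u in Set.Icc (κ : ℝ≥0∞) K, w u ∂μ :=
          setLIntegral_mono hw fun u hu => mul_le_mul_left (expNeg_antitone hu.2) _
      _ = _ := (lintegral_indicator measurableSet_Icc w).symm
  rw [← meanPatternBridge_empty_empty 0 0 μ x]
  simp only [meanPatternBridge, hstart, hfree]
  rw [lintegral_mul_bridgeTail (hw.indicator measurableSet_Icc), lintegral_mul_bridgeTail hw,
    ← mul_assoc]
  exact mul_le_mul_left hint _

theorem reasonableFactor_mul_gapBridge_mul_le (x : ℤ) (l n : ℕ) :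
    reasonableFactor κ K μ * (gapBridge κ K μ l l * meanBridge μ (n + 1)) ≤
      meanPatternBridge κ K μ (Set.Ioc x (x + l)) {x + (l : ℤ)} x (l + (n + 1)) := by
  rw [mul_left_comm, ← meanPatternBridge_Ioo_empty κ K μ x]
  refine (mul_le_mul_right (reasonableFactor_mul_meanBridge_le (x + l) n) _).trans
    (meanPatternBridge_mul_le (by simpa using Set.Ioo_subset_Ico_self) (by simp) ?_)
  rintro v ⟨h₁, h₂⟩
  refine ⟨h₂.1, fun z hz => h₁.2 z ⟨⟨hz.1.1, lt_of_le_of_ne hz.1.2 hz.2⟩, id⟩⟩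

theorem pairwiseDisjoint_first_reasonable :
    (Set.Ici 1).PairwiseDisjoint fun l : ℕ => envPattern κ K (Set.Ioc 0 l) {(l : ℤ)} := by
  have hfirst : ∀ {l l' : ℕ} {v : ℤ → ℝ≥0∞}, 1 ≤ l → l < l' →
      v ∈ envPattern κ K (Set.Ioc 0 l) {(l : ℤ)} →
        v ∉ envPattern κ K (Set.Ioc 0 l') {(l' : ℤ)} := fun hl hll' hv hv' =>
    hv'.2 _ ⟨⟨by omega, by omega⟩, by simpa using hll'.ne⟩ (hv.1 _ rfl)
  intro l hl l' hl' hne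
  refine Set.disjoint_left.2 fun v hv hv' => ?_
  rcases lt_or_gt_of_ne hne with h | h
  · exact hfirst hl h hv hv'
  · exact hfirst hl' h hv' hv

theorem sum_gapBridge_mul_le {N n : ℕ} (hN : N < n) :
    ∑ l ∈ Finset.Icc 1 N, reasonableFactor κ K μ * (gapBridge κ K μ l l * meanBridge μ (n - l)) ≤
      meanBridge μ n := by
  have hterm : ∀ l ∈ Finset.Icc 1 N, reasonableFactor κ K μ *
      (gapBridge κ K μ l l * meanBridge μ (n - l)) ≤
        ∫⁻ v in envPattern κ K (Set.Ioc 0 l) {(l : ℤ)}, bridgeWeight v 0 n ∂envLaw μ := by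
    intro l hl
    have hlN := (Finset.mem_Icc.1 hl).2
    obtain ⟨j, rfl⟩ : ∃ j, n = l + (j + 1) := ⟨n - l - 1, by omega⟩
    rw [add_tsub_cancel_left, ← meanPatternBridge_eq_setLIntegral]
    simpa only [zero_add] using reasonableFactor_mul_gapBridge_mul_le 0 l j
  refine (Finset.sum_le_sum hterm).trans ?_
  rw [← lintegral_biUnion_finset (pairwiseDisjoint_first_reasonable.subset fun l hl =>
    (Finset.mem_Icc.1 hl).1) fun l _ => measurableSet_envPattern ..]
  exact setLIntegral_le_lintegral _ _

theorem exists_one_le_sum_mul_pow {q : ℝ≥0} (hq : 0 < q) :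
    ∃ (N : ℕ) (θ : ℝ≥0), 0 < θ ∧ θ < 1 ∧ 1 ≤ ∑ l ∈ Finset.Icc 1 N, q / (2 * l) * θ ^ l := by
  obtain ⟨N, hN⟩ := exists_nat_ge (Real.exp (4 / q))
  have hharm : 4 / (q : ℝ) ≤ ∑ l ∈ Finset.Icc 1 N, (l : ℝ)⁻¹ := by
    have hlog : 4 / (q : ℝ) ≤ Real.log ↑(N + 1) := by
      rw [Real.le_log_iff_exp_le (by positivity)]
      push_cast
      linarith
    refine (hlog.trans (log_add_one_le_harmonic N)).trans_eq ?_
    rw [harmonic_eq_sum_Icc]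
    push_cast
    rfl
  have hN0 : N ≠ 0 := by
    rintro rfl
    exact absurd hN (not_le.2 (by simpa using Real.exp_pos _))
  set θ : ℝ≥0 := 2⁻¹ ^ (N : ℝ)⁻¹
  have hθN : θ ^ N = 2⁻¹ := NNReal.rpow_inv_natCast_pow 2⁻¹ hN0
  have hθ1 : θ < 1 := NNReal.rpow_lt_one (inv_lt_one_of_one_lt₀ one_lt_two) (by positivity)
  refine ⟨N, θ, NNReal.rpow_pos (by positivity), hθ1, ?_⟩
  calc (1 : ℝ≥0) = q / 2 * (4 / q) * θ ^ N := by
        rw [hθN]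
        field_simp
        norm_num
    _ ≤ q / 2 * (∑ l ∈ Finset.Icc 1 N, (l : ℝ≥0)⁻¹) * θ ^ N := by
        gcongr
        rw [← NNReal.coe_le_coe]
        push_cast
        exact hharm
    _ ≤ ∑ l ∈ Finset.Icc 1 N, q / (2 * l) * θ ^ l := by
        rw [Finset.mul_sum, Finset.sum_mul]
        refine Finset.sum_le_sum fun l hl => ?_
        rw [← div_eq_mul_inv, div_div]
        exact mul_le_mul_right (pow_le_pow_of_le_one zero_le hθ1.le (Finset.mem_Icc.1 hl).2) _

/-- If splitting off a piece of a gap costs a factor proportional to its length, then, the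
harmonic series being divergent, long gaps are exponentially unlikely. -/
theorem le_of_renewal {β : ℕ → ℝ≥0∞} {h : ℕ → ℕ → ℝ≥0∞} {q θ M : ℝ≥0} {N : ℕ} (hθ : θ ≤ 1)
    (hM : 1 ≤ M * θ ^ N) (hhβ : ∀ L n, h L n ≤ β n)
    (hsplit : ∀ l L n, 1 ≤ l → 1 ≤ n → L ≤ n →
      h (l + L) (l + n) ≤ (2 * l : ℝ≥0) * (h l l * h L n))
    (hβ : ∀ n, N < n → ∑ l ∈ Finset.Icc 1 N, q * (h l l * β (n - l)) ≤ β n)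
    (hN : 1 ≤ ∑ l ∈ Finset.Icc 1 N, q / (2 * l) * θ ^ l) {L n : ℕ} (hLn : L ≤ n) :
    h L n ≤ (M * θ ^ L : ℝ≥0) * β n := by
  induction L using Nat.strong_induction_on generalizing n with
  | _ L ih =>
  rcases le_or_gt L N with hL | hL
  · refine (hhβ L n).trans (le_mul_of_one_le_left' ?_)
    exact_mod_cast hM.trans (by gcongr M * ?_; exact pow_le_pow_of_le_one zero_le hθ hL)
  have hpiece : ∀ l ∈ Finset.Icc 1 N, (q / (2 * l) * θ ^ l : ℝ≥0) * h L n ≤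
      (M * θ ^ L : ℝ≥0) * (q * (h l l * β (n - l))) := by
    intro l hl
    obtain ⟨h1, h2⟩ := Finset.mem_Icc.1 hl
    obtain ⟨L, rfl⟩ : ∃ j, L = l + j := ⟨L - l, by omega⟩
    obtain ⟨n, rfl⟩ : ∃ j, n = l + j := ⟨n - l, by omega⟩
    rw [add_tsub_cancel_left]
    have hl0 : (l : ℝ≥0) ≠ 0 := Nat.cast_ne_zero.2 (by omega)
    have hcoeff : q / (2 * l) * θ ^ l * (2 * l) * (M * θ ^ L) = M * θ ^ (l + L) * q := by
      field_simp
      ring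
    calc (q / (2 * l) * θ ^ l : ℝ≥0) * h (l + L) (l + n)
        ≤ (q / (2 * l) * θ ^ l : ℝ≥0) *
            ((2 * l : ℝ≥0) * (h l l * ((M * θ ^ L : ℝ≥0) * β n))) := by
          gcongr
          refine (hsplit l L n h1 (by omega) (by omega)).trans ?_
          gcongr
          exact ih L (by omega) (by omega)
      _ = (q / (2 * l) * θ ^ l * (2 * l) * (M * θ ^ L) : ℝ≥0) * (h l l * β n) := by
          push_cast
          ring
      _ = _ := by rw [hcoeff, ENNReal.coe_mul, mul_assoc]
  calc h L n ≤ (∑ l ∈ Finset.Icc 1 N, q / (2 * l) * θ ^ l : ℝ≥0) * h L n :=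
        le_mul_of_one_le_left' (by exact_mod_cast hN)
    _ ≤ ∑ l ∈ Finset.Icc 1 N, (M * θ ^ L : ℝ≥0) * (q * (h l l * β (n - l))) := by
        rw [ENNReal.ofNNReal_finsetSum, Finset.sum_mul]
        exact Finset.sum_le_sum hpiece
    _ ≤ (M * θ ^ L : ℝ≥0) * β n := by
        rw [← Finset.mul_sum]
        gcongr
        exact hβ n (by omega)

variable (κ K μ) in
/-- The annealed weight of the bridges that start with a gap of length `L` is at most `M θ ^ L`
times that of all bridges. -/
def GapDecay (M θ : ℝ≥0) : Prop :=
  ∀ ⦃L n : ℕ⦄, L ≤ n → gapBridge κ K μ L n ≤ (M * θ ^ L : ℝ≥0) * meanBridge μ n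

theorem exists_gapDecay (hp : 0 < μ (Set.Icc (κ : ℝ≥0∞) K)) :
    ∃ M θ : ℝ≥0, 0 < θ ∧ θ < 1 ∧ GapDecay κ K μ M θ := by
  have hK : expNeg K ≠ 0 := by
    rw [← pos_iff_ne_zero, expNeg, EReal.zero_lt_exp_iff, bot_lt_iff_ne_bot, Ne,
      EReal.neg_eq_bot_iff]
    simp
  obtain ⟨q, hq⟩ : ∃ q : ℝ≥0, (q : ℝ≥0∞) = reasonableFactor κ K μ :=
    ⟨_, ENNReal.coe_toNNReal (ENNReal.mul_ne_top (expNeg_ne_top K) (measure_ne_top μ _))⟩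
  have hq0 : 0 < q := by
    rw [← ENNReal.coe_pos, hq]
    exact ENNReal.mul_pos hK hp.ne'
  obtain ⟨N, θ, hθ, hθ1, hN⟩ := exists_one_le_sum_mul_pow hq0
  refine ⟨(θ ^ N)⁻¹, θ, hθ, hθ1, fun L n hLn => ?_⟩
  refine le_of_renewal hθ1.le (inv_mul_cancel₀ (by positivity)).ge (gapBridge_le_meanBridge κ K μ)
    (fun l L n => gapBridge_add_le) (fun n hn => ?_) hN hLn
  rw [hq]
  exact sum_gapBridge_mul_le hn

end Renewal

/-! ### Several gaps -/

section Gaps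

variable {κ K : ℝ≥0} {μ : Measure ℝ≥0∞} [IsProbabilityMeasure μ] {M θ : ℝ≥0}

theorem meanPatternBridge_insert_le (hκ : 0 < κ) {x : ℤ} {l L n : ℕ} (hl : 1 ≤ l) (hL : 1 ≤ L)
    (hLn : L ≤ n) {X : Set ℤ} (hX : X ⊆ Set.Ioo (x + l) (x + l + L)) :
    meanPatternBridge κ K μ (Set.Ioo x (x + l + L)) (insert (x + (l : ℤ)) X) x (l + n) ≤
      killingConst κ * (gapBridge κ K μ l l *
        meanPatternBridge κ K μ (Set.Ioo (x + l) (x + l + L)) X (x + l) n) := by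
  have hlt : x + l < x + l + L := by omega
  rw [← meanPatternBridge_Ioo_empty κ K μ x l l]
  refine meanPatternBridge_add_le ?_ ?_ (Set.subset_inter ?_ ?_) fun v hv =>
    bridgeWeight_add_le_of_killing hκ hl (hL.trans hLn) (hv.1 _ (Set.mem_insert _ _)).1
  · simpa using Set.Ioo_subset_Ico_self
  · exact (Set.union_subset le_rfl hX).trans
      (Set.Ioo_subset_Ico_self.trans (Set.Ico_subset_Ico_right (by omega)))
  · refine envPattern_subset κ K (Set.Ioo_subset_Ioo_right hlt.le) (Set.empty_subset _) ?_
    rintro z ⟨hz, rfl | hzX⟩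
    · exact lt_irrefl _ hz.2
    · exact lt_asymm hz.2 (hX hzX).1
  · refine envPattern_subset κ K (Set.Ioo_subset_Ioo_left (by omega)) (Set.subset_insert _ _) ?_
    rintro z ⟨hz, rfl | hzX⟩
    · exact (lt_irrefl _ hz.1).elim
    · exact hzX

theorem meanPatternBridge_le (hκ : 0 < κ) (hgap : GapDecay κ K μ M θ) (X : Finset ℤ) {x : ℤ}
    {L n : ℕ} (hLn : L ≤ n) (hX : ↑X ⊆ Set.Ioo x (x + L)) :
    meanPatternBridge κ K μ (Set.Ioo x (x + L)) X x n ≤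
      ((killingConst κ * M) ^ (X.card + 1) * θ ^ L : ℝ≥0) * meanBridge μ n := by
  induction X using Finset.induction_on_min generalizing x L n with
  | empty =>
    rw [Finset.coe_empty, meanPatternBridge_Ioo_empty]
    refine (hgap hLn).trans ?_
    rw [Finset.card_empty, zero_add, pow_one]
    gcongr
    exact le_mul_of_one_le_left' (one_le_killingConst hκ)
  | insert z X hz ih =>
    have hzx := hX (Finset.mem_insert_self z X)
    obtain ⟨l, rfl⟩ : ∃ l : ℕ, z = x + l := ⟨(z - x).toNat, by have := hzx.1; omega⟩
    have hzx := Set.mem_Ioo.1 hzx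
    obtain ⟨L, rfl⟩ : ∃ j, L = l + j := ⟨L - l, by omega⟩
    obtain ⟨n, rfl⟩ : ∃ j, n = l + j := ⟨n - l, by omega⟩
    push_cast [← add_assoc] at hX hzx ⊢
    have hX' : ↑X ⊆ Set.Ioo (x + l) (x + l + L) := fun u hu =>
      ⟨hz u hu, (hX (Set.mem_insert_of_mem _ hu)).2⟩
    calc meanPatternBridge κ K μ (Set.Ioo x (x + l + L)) (insert (x + (l : ℤ)) X) x (l + n)
        ≤ killingConst κ * (gapBridge κ K μ l l *
            meanPatternBridge κ K μ (Set.Ioo (x + l) (x + l + L)) X (x + l) n) :=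
          meanPatternBridge_insert_le hκ (by omega) (by omega) (by omega) hX'
      _ ≤ killingConst κ * ((M * θ ^ l : ℝ≥0) * meanBridge μ l *
            (((killingConst κ * M) ^ (X.card + 1) * θ ^ L : ℝ≥0) * meanBridge μ n)) := by
          gcongr
          · exact hgap le_rfl
          · exact ih (by omega) hX'
      _ = ((killingConst κ * M) ^ (X.card + 1 + 1) * θ ^ (l + L) : ℝ≥0) *
            (meanBridge μ l * meanBridge μ n) := by
          push_cast
          ring
      _ ≤ _ := by
          rw [Finset.card_insert_of_notMem fun h => lt_irrefl _ (hz _ h)]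
          push_cast
          gcongr
          exact meanBridge_mul_le l n

theorem envPattern_Ioo_subset_union (κ K : ℝ≥0) (x b : ℤ) (X : Set ℤ) :
    envPattern κ K (Set.Ioo x b) X ⊆
      envPattern κ K (Set.Ioo (x - 1) b) X ∪ envPattern κ K (Set.Ioo x b) (insert x X) := by
  intro v hv
  by_cases hx : v x ∈ Set.Icc (κ : ℝ≥0∞) K
  · exact Or.inr ⟨Set.forall_mem_insert.2 ⟨hx, hv.1⟩,
      fun z hz => hv.2 z ⟨hz.1, fun h => hz.2 (Set.mem_insert_of_mem _ h)⟩⟩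
  · refine Or.inl ⟨hv.1, fun z hz => ?_⟩
    rcases eq_or_ne z x with rfl | hne
    · exact hx
    · exact hv.2 z ⟨⟨by have := hz.1.1; omega, hz.1.2⟩, hz.2⟩

theorem meanPatternBridge_le_add (hκ : 0 < κ) {x b : ℤ} {l n : ℕ} (hl : 1 ≤ l) (hn : 1 ≤ n)
    (hb : b ≤ x + l + n) {X : Set ℤ} (hX : X ⊆ Set.Ioo (x + l) b) :
    meanPatternBridge κ K μ (Set.Ioo (x + l) b) X x (l + n) ≤
      meanPatternBridge κ K μ (Set.Ioo (x + l - 1) b) X x (l + n) +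
        killingConst κ * (meanBridge μ l *
          meanPatternBridge κ K μ (Set.Ioo (x + l) b) X (x + l) n) := by
  have hsplit : meanPatternBridge κ K μ (Set.Ioo (x + l) b) (insert (x + (l : ℤ)) X) x (l + n) ≤
      killingConst κ * (meanPatternBridge κ K μ ∅ ∅ x l *
        meanPatternBridge κ K μ (Set.Ioo (x + l) b) X (x + l) n) := by
    refine meanPatternBridge_add_le (by simp) ?_ (Set.subset_inter ?_ ?_) fun v hv =>
      bridgeWeight_add_le_of_killing hκ hl hn (hv.1 _ (Set.mem_insert _ _)).1
    · exact (Set.union_subset le_rfl hX).trans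
        (Set.Ioo_subset_Ico_self.trans (Set.Ico_subset_Ico_right hb))
    · exact envPattern_subset κ K (Set.empty_subset _) (Set.empty_subset _) (by simp)
    · refine envPattern_subset κ K le_rfl (Set.subset_insert _ _) ?_
      rintro z ⟨hz, rfl | hzX⟩
      · exact (lt_irrefl _ hz.1).elim
      · exact hzX
  rw [meanPatternBridge_empty_empty] at hsplit
  refine le_trans ?_ (add_le_add_right hsplit _)
  simp only [meanPatternBridge_eq_setLIntegral]
  exact (lintegral_mono_set (envPattern_Ioo_subset_union ..)).trans (lintegral_union_le _ _ _)

theorem inv_one_sub_mul_add_one (hθ : θ < 1) : (1 - θ)⁻¹ * θ + 1 = (1 - θ)⁻¹ := by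
  nth_rewrite 2 [← inv_mul_cancel₀ (tsub_pos_of_lt hθ).ne']
  rw [← mul_add, add_tsub_cancel_of_le hθ.le, mul_one]

theorem one_le_killingConst_mul_inv_one_sub (hκ : 0 < κ) (hθ : θ < 1) :
    1 ≤ killingConst κ * (1 - θ)⁻¹ :=
  one_le_mul (one_le_killingConst hκ) ((one_le_inv₀ (tsub_pos_of_lt hθ)).2 tsub_le_self)

theorem meanPatternBridge_add_right_le (hκ : 0 < κ) (hgap : GapDecay κ K μ M θ) (hθ : θ < 1)
    (X : Finset ℤ) (x : ℤ) (a : ℕ) {L n : ℕ} (hL : 1 ≤ L) (hLn : L ≤ n)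
    (hX : ↑X ⊆ Set.Ioo (x + a) (x + a + L)) :
    meanPatternBridge κ K μ (Set.Ioo (x + a) (x + a + L)) X x (a + n) ≤
      (killingConst κ * (1 - θ)⁻¹ * (killingConst κ * M) ^ (X.card + 1) * θ ^ L : ℝ≥0) *
        meanBridge μ (a + n) := by
  set g := killingConst κ
  set D := (g * M) ^ (X.card + 1)
  induction a generalizing L n with
  | zero =>
    simp only [Nat.cast_zero, add_zero, zero_add] at hX ⊢
    refine (meanPatternBridge_le hκ hgap X hLn hX).trans ?_
    gcongr
    exact le_mul_of_one_le_left' (one_le_killingConst_mul_inv_one_sub hκ hθ)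
  | succ a ih =>
    have hcoeff : g * (1 - θ)⁻¹ * D * θ ^ (L + 1) + g * (D * θ ^ L) =
        g * (1 - θ)⁻¹ * D * θ ^ L := by
      calc _ = g * ((1 - θ)⁻¹ * θ + 1) * D * θ ^ L := by ring
        _ = _ := by rw [inv_one_sub_mul_add_one hθ]
    have hIoo : Set.Ioo (x + (a + 1 : ℕ) - 1) (x + (a + 1 : ℕ) + L) =
        Set.Ioo (x + a) (x + a + (L + 1 : ℕ)) := by
      congr 1 <;> push_cast <;> ring
    calc meanPatternBridge κ K μ (Set.Ioo (x + (a + 1 : ℕ)) (x + (a + 1 : ℕ) + L)) X x (a + 1 + n)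
        ≤ meanPatternBridge κ K μ (Set.Ioo (x + a) (x + a + (L + 1 : ℕ))) X x (a + (n + 1)) +
          g * (meanBridge μ (a + 1) * meanPatternBridge κ K μ
            (Set.Ioo (x + (a + 1 : ℕ)) (x + (a + 1 : ℕ) + L)) X (x + (a + 1 : ℕ)) n) := by
          rw [← hIoo, add_comm n 1, ← add_assoc]
          exact meanPatternBridge_le_add hκ (by omega) (by omega) (by omega) hX
      _ ≤ (g * (1 - θ)⁻¹ * D * θ ^ (L + 1) : ℝ≥0) * meanBridge μ (a + (n + 1)) +
          g * (meanBridge μ (a + 1) * ((D * θ ^ L : ℝ≥0) * meanBridge μ n)) := by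
          gcongr
          · exact ih (by omega) (by omega) (hX.trans (hIoo ▸ Set.Ioo_subset_Ioo_left (by omega)))
          · exact meanPatternBridge_le hκ hgap X hLn hX
      _ = (g * (1 - θ)⁻¹ * D * θ ^ (L + 1) : ℝ≥0) * meanBridge μ (a + 1 + n) +
          (g * (D * θ ^ L) : ℝ≥0) * (meanBridge μ (a + 1) * meanBridge μ n) := by
          push_cast
          ring_nf
      _ ≤ (g * (1 - θ)⁻¹ * D * θ ^ (L + 1) : ℝ≥0) * meanBridge μ (a + 1 + n) +
          (g * (D * θ ^ L) : ℝ≥0) * meanBridge μ (a + 1 + n) := by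
          gcongr
          exact meanBridge_mul_le (a + 1) n
      _ = _ := by rw [← add_mul, ← ENNReal.coe_add, hcoeff]

variable (κ K μ) in
/-- The annealed weight of the bridges from `0`, on the event that the reasonable sites of a
bounded interval are prescribed, decays exponentially in the length of the interval, at the cost
of a factor `M` for every gap. -/
def PatternDecay (M θ : ℝ≥0) : Prop :=
  ∀ ⦃a L n : ℕ⦄ (X : Finset ℤ), 1 ≤ L → a + L ≤ n → ↑X ⊆ Set.Ioo (a : ℤ) (a + L) →
    meanPatternBridge κ K μ (Set.Ioo a (a + L)) X 0 n ≤
      (M ^ (X.card + 1) * θ ^ L : ℝ≥0) * meanBridge μ n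

theorem exists_patternDecay (hκ : 0 < κ) (hp : 0 < μ (Set.Icc (κ : ℝ≥0∞) K)) :
    ∃ M θ : ℝ≥0, 0 < θ ∧ θ < 1 ∧ PatternDecay κ K μ M θ := by
  obtain ⟨M, θ, hθ0, hθ, hgap⟩ := exists_gapDecay hp
  refine ⟨killingConst κ * (1 - θ)⁻¹ * (killingConst κ * M), θ, hθ0, hθ,
    fun a L n X hL hn hX => ?_⟩
  obtain ⟨n, rfl⟩ : ∃ j, n = a + j := ⟨n - a, by omega⟩
  have hfrom := meanPatternBridge_add_right_le (K := K) hκ hgap hθ X 0 a hL (n := n) (by omega)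
    (by simpa only [zero_add] using hX)
  simp only [zero_add] at hfrom
  refine hfrom.trans ?_
  rw [mul_pow (killingConst κ * (1 - θ)⁻¹)]
  gcongr
  exact le_self_pow₀ (one_le_killingConst_mul_inv_one_sub hκ hθ) X.card.succ_ne_zero

end Gaps

/-! ### Comparison of the weighted walk with its bridges -/

section Comparison

theorem measurable_partition (y x : ℤ) : Measurable fun v => partition v y x := by
  have : IsProbabilityMeasure (srw x) := by unfold srw; infer_instance
  exact (measurable_weight (V := fun z (v : ℤ → ℝ≥0∞) => v z)
    measurable_pi_apply y).lintegral_prod_right'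

/-- The environments without reasonable sites strictly between `-(k + 1)` and `0`. -/
abbrev leftGap (κ K : ℝ≥0) (k : ℕ) : Set (ℤ → ℝ≥0∞) :=
  envPattern κ K (Set.Ioo (-(k + 1 : ℕ)) 0) ∅

theorem exists_mem_leftGap {κ K : ℝ≥0} {v : ℤ → ℝ≥0∞}
    (hv : ∃ k : ℕ, v (-(k + 1 : ℕ)) ∈ Set.Icc (κ : ℝ≥0∞) K) :
    ∃ k : ℕ, v ∈ leftGap κ K k ∧ v (-(k + 1 : ℕ)) ∈ Set.Icc (κ : ℝ≥0∞) K := by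
  classical
  refine ⟨Nat.find hv, ⟨fun z hz => hz.elim, fun z hz hzv => ?_⟩, Nat.find_spec hv⟩
  have hz := Set.mem_Ioo.1 hz.1
  refine Nat.find_min hv (m := (-z - 1).toNat) (by omega) ?_
  rwa [show -(((-z - 1).toNat + 1 : ℕ) : ℤ) = z by omega]

theorem indicator_partition_le {κ K : ℝ≥0} (hκ : 0 < κ) {v : ℤ → ℝ≥0∞} {I X : Set ℤ} {n k : ℕ}
    (hn : 1 ≤ n) (hv : κ ≤ v (-(k + 1 : ℕ))) :
    (envPattern κ K I X).indicator (partition · n 0) v ≤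
      ENNReal.ofReal (2 * (killingConst κ + k)) * patternBridge κ K I X 0 n v := by
  obtain ⟨n, rfl⟩ := Nat.exists_eq_add_of_le' hn
  rw [patternBridge, ← Set.indicator_const_mul]
  exact Set.indicator_le_indicator (partition_le_bridgeWeight v n k
    (one_pos.trans_le (one_le_killingConst hκ)) (one_le_killingConst_mul hκ hv))

variable {κ K : ℝ≥0} {μ : Measure ℝ≥0∞} [IsProbabilityMeasure μ]

variable (κ K μ) in
theorem envLaw_leftGap (k : ℕ) : envLaw μ (leftGap κ K k) = (1 - μ (Set.Icc κ K)) ^ k := by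
  have hinter : leftGap κ K k = ⋂ z ∈ Finset.Ioo (-((k + 1 : ℕ) : ℤ)) 0,
      (fun v : ℤ → ℝ≥0∞ => v z) ⁻¹' (Set.Icc (κ : ℝ≥0∞) K)ᶜ := by
    ext v
    simp [reasonableExactly]
  have hsite (z : ℤ) : envLaw μ ((fun v : ℤ → ℝ≥0∞ => v z) ⁻¹' (Set.Icc (κ : ℝ≥0∞) K)ᶜ) =
      1 - μ (Set.Icc κ K) := by
    rw [(measurePreserving_eval_envLaw z).measure_preimage
      measurableSet_Icc.compl.nullMeasurableSet, prob_compl_eq_one_sub measurableSet_Icc]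
  rw [hinter, iIndepFun_envLaw.measure_inter_preimage_eq_mul _
    (sets := fun _ => (Set.Icc (κ : ℝ≥0∞) K)ᶜ) fun _ _ => measurableSet_Icc.compl,
    Finset.prod_congr rfl fun z _ => hsite z, Finset.prod_const, Int.card_Ioo]
  congr 1
  omega

theorem tsum_mul_envLaw_leftGap_ne_top (hp : 0 < μ (Set.Icc (κ : ℝ≥0∞) K)) (g : ℝ≥0) :
    ∑' k : ℕ, ENNReal.ofReal (2 * (g + k)) * envLaw μ (leftGap κ K k) ≠ ⊤ := by
  simp only [envLaw_leftGap]
  have hlt : 1 - μ (Set.Icc κ K) < 1 := ENNReal.sub_lt_self ENNReal.one_ne_top one_ne_zero hp.ne'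
  lift 1 - μ (Set.Icc κ K) to ℝ≥0 using hlt.ne_top with r
  have hr : ‖(r : ℝ)‖ < 1 := by simpa using hlt
  have hsum : Summable fun k : ℕ => 2 * ((g : ℝ) + k) * (r : ℝ) ^ k :=
    (((summable_geometric_of_norm_lt_one hr).mul_left (2 * (g : ℝ))).add
      ((summable_pow_mul_geometric_of_norm_lt_one 1 hr).mul_left 2)).congr fun k => by ring
  convert hsum.tsum_ofReal_ne_top using 4 with k
  rw [ENNReal.ofReal_mul (q := (r : ℝ) ^ k) (by positivity), ← NNReal.coe_pow,
    ENNReal.ofReal_coe_nnreal, ENNReal.coe_pow]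

theorem ae_exists_mem_leftGap (hp : 0 < μ (Set.Icc (κ : ℝ≥0∞) K)) :
    ∀ᵐ v ∂envLaw μ, ∃ k : ℕ, v ∈ leftGap κ K k ∧ v (-(k + 1 : ℕ)) ∈ Set.Icc (κ : ℝ≥0∞) K := by
  have hfin : ∑' k, envLaw μ (leftGap κ K k) ≠ ⊤ := by
    refine ne_top_of_le_ne_top (tsum_mul_envLaw_leftGap_ne_top hp 1)
      (ENNReal.tsum_le_tsum fun k => le_mul_of_one_le_left zero_le (ENNReal.one_le_ofReal.2 ?_))
    rw [NNReal.coe_one]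
    linarith [k.cast_nonneg (α := ℝ)]
  filter_upwards [ae_eventually_notMem hfin] with v hv
  refine exists_mem_leftGap ?_
  obtain ⟨k, hk⟩ := hv.exists
  by_contra! hne
  refine hk ⟨fun z hz => hz.elim, fun z hz => ?_⟩
  have hz := Set.mem_Ioo.1 hz.1
  have := hne (-z - 1).toNat
  rwa [show -(((-z - 1).toNat + 1 : ℕ) : ℤ) = z by omega] at this

theorem setLIntegral_leftGap_patternBridge {I X : Set ℤ} {n : ℕ} (hIX : I ∪ X ⊆ Set.Ico 0 n)
    (k : ℕ) :
    ∫⁻ v in leftGap κ K k, patternBridge κ K I X 0 n v ∂envLaw μ =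
      envLaw μ (leftGap κ K k) * meanPatternBridge κ K μ I X 0 n := by
  have hgap := measurableSet_envPattern κ K (Set.Ioo (-(k + 1 : ℕ)) 0) ∅
  have hdep : DependsOn ((leftGap κ K k).indicator (1 : (ℤ → ℝ≥0∞) → ℝ≥0∞))
      (Finset.Ioo (-((k + 1 : ℕ) : ℤ)) 0 : Finset ℤ) := by
    intro v w hvw
    rw [Finset.coe_Ioo] at hvw
    have hmem : v ∈ leftGap κ K k ↔ w ∈ leftGap κ K k :=
      mem_envPattern_congr fun z hz => hvw z (by simpa only [Set.union_empty] using hz)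
    by_cases hv : v ∈ leftGap κ K k
    · rw [Set.indicator_of_mem hv, Set.indicator_of_mem (hmem.1 hv), Pi.one_apply, Pi.one_apply]
    · rw [Set.indicator_of_notMem hv, Set.indicator_of_notMem (mt hmem.2 hv)]
  have hdisj : Disjoint (Finset.Ioo (-((k + 1 : ℕ) : ℤ)) 0) (Finset.Ico (0 : ℤ) (0 + n)) :=
    Finset.disjoint_left.2 fun z h1 h2 => by
      simp only [Finset.mem_Ico, Finset.mem_Ioo] at h1 h2
      omega
  rw [← lintegral_indicator hgap, meanPatternBridge, ← lintegral_indicator_one hgap,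
    ← lintegral_mul_of_dependsOn iIndepFun_envLaw (measurable_one.indicator hgap)
      (measurable_patternBridge ..) hdisj hdep
      (dependsOn_patternBridge κ K (by simpa only [zero_add] using hIX))]
  refine lintegral_congr fun v => ?_
  rw [← Set.indicator_mul_left]
  simp only [Pi.one_apply, one_mul]

-- The walk pays a factor `2 * (g + k)` for its excursions to the left of `0` when the first
-- reasonable site there is `-(k + 1)`, and this distance has exponential tails.
theorem exists_setLIntegral_partition_le (hκ : 0 < κ) (hp : 0 < μ (Set.Icc (κ : ℝ≥0∞) K)) :
    ∃ C : ℝ≥0, ∀ ⦃n : ℕ⦄ ⦃I X : Set ℤ⦄, 1 ≤ n → I ∪ X ⊆ Set.Ico 0 n →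
      ∫⁻ v in envPattern κ K I X, partition v n 0 ∂envLaw μ ≤
        C * meanPatternBridge κ K μ I X 0 n := by
  set g := killingConst κ
  have htop := tsum_mul_envLaw_leftGap_ne_top hp g
  refine ⟨(∑' k : ℕ, ENNReal.ofReal (2 * (g + k)) * envLaw μ (leftGap κ K k)).toNNReal,
    fun n I X hn hIX => ?_⟩
  have hgap (k : ℕ) := measurableSet_envPattern κ K (Set.Ioo (-(k + 1 : ℕ)) 0) ∅
  have hbound : ∀ᵐ v ∂envLaw μ, (envPattern κ K I X).indicator (partition · n 0) v ≤
      ∑' k : ℕ, (leftGap κ K k).indicator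
        (fun v => ENNReal.ofReal (2 * (g + k)) * patternBridge κ K I X 0 n v) v := by
    filter_upwards [ae_exists_mem_leftGap hp] with v ⟨k, hk, hreasonable⟩
    refine le_trans ?_ (ENNReal.le_tsum k)
    rw [Set.indicator_of_mem hk]
    exact indicator_partition_le hκ hn hreasonable.1
  rw [ENNReal.coe_toNNReal htop, ← ENNReal.tsum_mul_right,
    ← lintegral_indicator (measurableSet_envPattern κ K I X)]
  calc ∫⁻ v, (envPattern κ K I X).indicator (partition · n 0) v ∂envLaw μ
      ≤ ∫⁻ v, ∑' k : ℕ, (leftGap κ K k).indicator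
          (fun v => ENNReal.ofReal (2 * (g + k)) * patternBridge κ K I X 0 n v) v ∂envLaw μ :=
        lintegral_mono_ae hbound
    _ = ∑' k : ℕ, ENNReal.ofReal (2 * (g + k)) *
          ∫⁻ v in leftGap κ K k, patternBridge κ K I X 0 n v ∂envLaw μ := by
        rw [lintegral_tsum fun k => (((measurable_patternBridge ..).const_mul _).indicator
          (hgap k)).aemeasurable]
        refine tsum_congr fun k => ?_
        rw [lintegral_indicator (hgap k), lintegral_const_mul _ (measurable_patternBridge ..)]
    _ = _ := by simp only [setLIntegral_leftGap_patternBridge hIX, mul_assoc]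

end Comparison

/-! ### The measures on environments and paths -/

section Measures

theorem reasonableExactly_empty_empty {Ω : Type*} (V : ℤ → Ω → ℝ≥0∞) (κ K : ℝ≥0) :
    reasonableExactly V κ K ∅ ∅ = Set.univ := by
  simp [reasonableExactly]

variable {Ω : Type*} [MeasurableSpace Ω] {P : Measure Ω} {V : ℤ → Ω → ℝ≥0∞}

theorem setLIntegral_reasonableExactly (hV : ∀ z, Measurable (V z)) (hindep : iIndepFun V P)
    (hident : ∀ z, IdentDistrib (V z) (V 0) P P) (κ K : ℝ≥0) (I X : Set ℤ)
    {F : (ℤ → ℝ≥0∞) → ℝ≥0∞} (hF : Measurable F) :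
    ∫⁻ ω in reasonableExactly V κ K I X, F (fun z => V z ω) ∂P =
      ∫⁻ v in envPattern κ K I X, F v ∂envLaw (P.map (V 0)) := by
  rw [← map_eq_envLaw hV hindep hident,
    setLIntegral_map (measurableSet_envPattern κ K I X) hF (measurable_pi_iff.2 hV)]
  rfl

theorem killedAveraged_bridgePaths_inter [SFinite P] (hV : ∀ z, Measurable (V z)) (n : ℕ)
    {E : Set Ω} (hE : MeasurableSet E) :
    killedAveraged P V hV 0 (Prod.snd ⁻¹' bridgePaths (n + 1 : ℕ) ∩ Prod.fst ⁻¹' E) =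
      ∫⁻ ω in E, bridgeWeight (fun z => V z ω) 0 (n + 1) ∂P := by
  rw [Set.inter_comm, ← Set.prod_eq, killedAveraged,
    Measure.compProd_apply_prod hE (measurableSet_bridgePaths _)]
  exact lintegral_congr fun ω => chainLaw_bridgePaths (fun z => V z ω) n

theorem weightedMeasure_fst_preimage [SFinite P] (hV : ∀ z, Measurable (V z)) (y : ℤ)
    {E : Set Ω} (hE : MeasurableSet E) :
    weightedMeasure P V 0 y (Prod.fst ⁻¹' E) =
      ∫⁻ ω in E, partition (fun z => V z ω) y 0 ∂P := by
  have : IsProbabilityMeasure (srw 0) := by unfold srw; infer_instance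
  rw [weightedMeasure, withDensity_apply _ (measurable_fst hE), ← Set.prod_univ,
    setLIntegral_prod _ (measurable_weight hV y).aemeasurable]
  simp only [Measure.restrict_univ]
  rfl

variable [IsProbabilityMeasure P]

theorem bridgeQ_reasonableExactly_le (hV : ∀ z, Measurable (V z)) (hindep : iIndepFun V P)
    (hident : ∀ z, IdentDistrib (V z) (V 0) P P) {κ K : ℝ≥0} {I X : Set ℤ} {n : ℕ} {D : ℝ≥0∞}
    (h : meanPatternBridge κ K (P.map (V 0)) I X 0 (n + 1) ≤
      D * meanBridge (P.map (V 0)) (n + 1)) :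
    bridgeQ P V hV 0 (n + 1 : ℕ) {q | q.1 ∈ reasonableExactly V κ K I X} ≤ D := by
  have := Measure.isProbabilityMeasure_map (μ := P) (hV 0).aemeasurable
  have hbridge (I X : Set ℤ) : killedAveraged P V hV 0 (Prod.snd ⁻¹' bridgePaths (n + 1 : ℕ) ∩
      Prod.fst ⁻¹' reasonableExactly V κ K I X) =
        meanPatternBridge κ K (P.map (V 0)) I X 0 (n + 1) := by
    rw [killedAveraged_bridgePaths_inter hV n (measurableSet_reasonableExactly κ K hV I X),
      setLIntegral_reasonableExactly hV hindep hident κ K I X (measurable_bridgeWeight 0 (n + 1)),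
      meanPatternBridge_eq_setLIntegral]
  have hnorm : killedAveraged P V hV 0 (Prod.snd ⁻¹' bridgePaths (n + 1 : ℕ)) =
      meanBridge (P.map (V 0)) (n + 1) := by
    rw [← meanPatternBridge_empty_empty κ K, ← hbridge, reasonableExactly_empty_empty,
      Set.preimage_univ, Set.inter_univ]
  change ProbabilityTheory.cond _ (Prod.snd ⁻¹' bridgePaths (n + 1 : ℕ))
    (Prod.fst ⁻¹' reasonableExactly V κ K I X) ≤ D
  rw [cond_apply (measurable_snd (measurableSet_bridgePaths _)), hnorm, hbridge, mul_comm,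
    ← div_eq_mul_inv]
  exact ENNReal.div_le_of_le_mul h

theorem annealedQ_reasonableExactly_le (hV : ∀ z, Measurable (V z)) (hindep : iIndepFun V P)
    (hident : ∀ z, IdentDistrib (V z) (V 0) P P) {κ K : ℝ≥0} {I X : Set ℤ} {n : ℕ} {D : ℝ≥0∞}
    (h : ∫⁻ v in envPattern κ K I X, partition v n 0 ∂envLaw (P.map (V 0)) ≤
      D * meanBridge (P.map (V 0)) n) :
    annealedQ P V 0 n {q | q.1 ∈ reasonableExactly V κ K I X} ≤ D := by
  have hpartition (I X : Set ℤ) : weightedMeasure P V 0 n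
      (Prod.fst ⁻¹' reasonableExactly V κ K I X) =
        ∫⁻ v in envPattern κ K I X, partition v n 0 ∂envLaw (P.map (V 0)) := by
    rw [weightedMeasure_fst_preimage hV n (measurableSet_reasonableExactly κ K hV I X),
      setLIntegral_reasonableExactly hV hindep hident κ K I X (measurable_partition n 0)]
  have hnorm : meanBridge (P.map (V 0)) n ≤ weightedMeasure P V 0 n Set.univ := by
    have huniv := hpartition ∅ ∅
    rw [envPattern, reasonableExactly_empty_empty, reasonableExactly_empty_empty,
      Set.preimage_univ, setLIntegral_univ] at huniv
    rw [huniv]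
    exact lintegral_mono fun v => bridgeWeight_le_partition v n
  change (weightedMeasure P V 0 n Set.univ)⁻¹ *
    weightedMeasure P V 0 n (Prod.fst ⁻¹' reasonableExactly V κ K I X) ≤ D
  rw [hpartition, mul_comm, ← div_eq_mul_inv]
  exact ENNReal.div_le_of_le_mul (h.trans (by gcongr))

end Measures

/-! ### Products over gaps -/

section Products

theorem prod_mul_zpow_sub {M θ : ℝ} (hθ : θ ≠ 0) {m : ℕ} (x : Fin (m + 2) → ℤ) :
    ∏ j : Fin (m + 1), M * θ ^ (x j.succ - x j.castSucc) =
      M ^ (m + 1) * θ ^ (x (Fin.last (m + 1)) - x 0) := by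
  rw [Finset.prod_mul_distrib, Finset.prod_const, Finset.card_univ, Fintype.card_fin]
  congr 1
  induction m with
  | zero => simp
  | succ m ih =>
    have hinit := ih fun i => x i.castSucc
    simp only [← Fin.succ_castSucc] at hinit
    rw [Fin.prod_univ_castSucc, hinit, ← zpow_add₀ hθ]
    congr 1
    simp

theorem mul_ofReal_prod_le (C : ℝ≥0) {m : ℕ} (f : Fin (m + 1) → ℝ) :
    C * ENNReal.ofReal (∏ j, f j) ≤ ENNReal.ofReal (∏ j, max 1 (C : ℝ) * f j) := by
  rw [Finset.prod_mul_distrib, Finset.prod_const, Finset.card_univ, Fintype.card_fin,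
    ENNReal.ofReal_mul (by positivity)]
  gcongr
  have hC : (C : ℝ) ≤ max 1 (C : ℝ) ^ (m + 1) :=
    (le_max_right _ _).trans (le_self_pow₀ (le_max_left _ _) m.succ_ne_zero)
  simpa only [ENNReal.ofReal_coe_nnreal] using ENNReal.ofReal_le_ofReal hC

theorem range_interior_subset_Ioo {m : ℕ} {x : Fin (m + 2) → ℤ} (hx : StrictMono x) :
    Set.range (fun i : Fin m => x i.succ.castSucc) ⊆ Set.Ioo (x 0) (x (Fin.last (m + 1))) := by
  rintro _ ⟨i, rfl⟩
  exact ⟨hx (by simp [Fin.lt_def]), hx (by simp [Fin.lt_def])⟩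

theorem PatternDecay.le_prod {κ K : ℝ≥0} {μ : Measure ℝ≥0∞} {M θ : ℝ≥0}
    (h : PatternDecay κ K μ M θ) (hθ : 0 < θ) {m n : ℕ} {x : Fin (m + 2) → ℤ}
    (hx : StrictMono x) (h0 : 0 ≤ x 0) (hn : x (Fin.last (m + 1)) ≤ n) :
    meanPatternBridge κ K μ (Set.Ioo (x 0) (x (Fin.last (m + 1))))
        (Set.range fun i : Fin m => x i.succ.castSucc) 0 n ≤
      ENNReal.ofReal (∏ j : Fin (m + 1), (M : ℝ) * (θ : ℝ) ^ (x j.succ - x j.castSucc)) *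
        meanBridge μ n := by
  have hlt : x 0 < x (Fin.last (m + 1)) := hx Fin.last_pos
  have hinterior := range_interior_subset_Ioo hx
  obtain ⟨a, ha⟩ := Int.eq_ofNat_of_zero_le h0
  obtain ⟨L, hL⟩ : ∃ L : ℕ, x (Fin.last (m + 1)) = a + L :=
    ⟨(x (Fin.last (m + 1)) - a).toNat, by omega⟩
  set X : Finset ℤ := Finset.univ.map ⟨fun i : Fin m => x i.succ.castSucc,
    hx.injective.comp ((Fin.castSucc_injective _).comp (Fin.succ_injective _))⟩
  have hX : (X : Set ℤ) = Set.range fun i : Fin m => x i.succ.castSucc := by simp [X]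
  have hcard : X.card = m := by simp [X]
  rw [prod_mul_zpow_sub (by exact_mod_cast hθ.ne'), ← hX]
  rw [hL, ha] at hinterior ⊢
  refine (h X (by omega) (by omega) (hX ▸ hinterior)).trans_eq ?_
  rw [add_sub_cancel_left, zpow_natCast, hcard]
  norm_cast
  rw [ENNReal.ofReal_coe_nnreal]

end Products

end RandomPotential

end

open RandomPotential

theorem theorem4p1 {Ω : Type*} [MeasurableSpace Ω] (P : Measure Ω) [IsProbabilityMeasure P]
    (V : ℤ → Ω → ℝ≥0∞) (hV : ∀ z, Measurable (V z))
    (hindep : iIndepFun V P) (hident : ∀ z, IdentDistrib (V z) (V 0) P P)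
    (κ K : ℝ≥0) (hκ : 0 < κ) (hκK : 0 < P {ω | V 0 ω ∈ Set.Icc (κ : ℝ≥0∞) K}) :
    ∃ M₁ M₂ θ : ℝ, 0 < θ ∧ θ < 1 ∧
      ∀ (m : ℕ) (a b y : ℤ) (x : Fin (m + 2) → ℤ),
        StrictMono x → x 0 = a → x (Fin.last (m + 1)) = b → 0 ≤ a → b ≤ y →
        RandomPotential.bridgeQ P V hV 0 y
            {q | q.1 ∈ RandomPotential.reasonableExactly V κ K (Set.Ioo a b)
              (Set.range fun i : Fin m => x i.succ.castSucc)} ≤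
          ENNReal.ofReal (∏ j : Fin (m + 1), M₁ * θ ^ (x j.succ - x j.castSucc)) ∧
        RandomPotential.annealedQ P V 0 y
            {q | q.1 ∈ RandomPotential.reasonableExactly V κ K (Set.Ioo a b)
              (Set.range fun i : Fin m => x i.succ.castSucc)} ≤
          ENNReal.ofReal (∏ j : Fin (m + 1), M₂ * θ ^ (x j.succ - x j.castSucc)) := by
  have := Measure.isProbabilityMeasure_map (μ := P) (hV 0).aemeasurable
  have hp : 0 < P.map (V 0) (Set.Icc κ K) := by rwa [Measure.map_apply (hV 0) measurableSet_Icc]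
  obtain ⟨M, θ, hθ0, hθ, hdecay⟩ := exists_patternDecay hκ hp
  obtain ⟨C, hC⟩ := exists_setLIntegral_partition_le hκ hp
  refine ⟨M, max 1 (C : ℝ) * M, θ, by exact_mod_cast hθ0, by exact_mod_cast hθ, ?_⟩
  rintro m a b y x hx rfl rfl ha hby
  have hlt : x 0 < x (Fin.last (m + 1)) := hx Fin.last_pos
  obtain ⟨n, rfl⟩ : ∃ n : ℕ, y = (n + 1 : ℕ) := ⟨(y - 1).toNat, by omega⟩
  have hbridge := hdecay.le_prod hθ0 hx ha hby
  refine ⟨bridgeQ_reasonableExactly_le hV hindep hident hbridge,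
    annealedQ_reasonableExactly_le hV hindep hident ?_⟩
  have hsites : Set.Ioo (x 0) (x (Fin.last (m + 1))) ∪
      Set.range (fun i : Fin m => x i.succ.castSucc) ⊆ Set.Ico 0 (n + 1 : ℕ) :=
    (Set.union_subset le_rfl (range_interior_subset_Ioo hx)).trans
      (Set.Ioo_subset_Ico_self.trans (Set.Ico_subset_Ico ha hby))
  refine (hC n.succ_pos hsites).trans ((mul_le_mul_right hbridge _).trans ?_)
  rw [← mul_assoc]
  gcongr
  simpa only [mul_assoc] using
    mul_ofReal_prod_le C fun j => (M : ℝ) * (θ : ℝ) ^ (x j.succ - x j.castSucc)
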